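/- **Setting.** Fix a set $P$ of nouns and a set $R$ of verbs. *Terms* are given by $t ::= p \mid (r\ \mathrm{all}\ t)$ with $p\in P$, $r\in R$. The sentences of $\mathcal L_{1.5}$ are $\forall(x,y)$ ("all $x$ are $y$") and $\exists(x,y)$ ("some $x$ are $y$"), for terms $x,y$; the extended language $\mathcal L_{1.5}^+$ has in addition the sentences $\forall(a,b)\vee\exists(x,y)$ ("all $a$ are $b$, or some $x$ are $y$"), for terms $a,b,x,y$. A model is a (possibly empty) set $M$ with a subset $[\![p]\!]\subseteq M$ for each noun and a relation $[\![r]\!]\subseteq M\times M$ for each verb; $[\![r\ \mathrm{all}\ x]\!]=\{m\in M:\ m\,[\![r]\!]\,n \text{ for all } n\in[\![x]\!]\}$; $\forall(x,y)$ holds iff $[\![x]\!]\subseteq[\![y]\!]$, $\exists(x,y)$ holds iff $[\![x]\!]\cap[\![y]\!]\ne\emptyset$, and $\forall(a,b)\vee\exists(x,y)$ holds iff one of the two does. $\Gamma\models\phi$ means that every model of all sentences of $\Gamma$ satisfies $\phi$. **Proof system.** Let $\vdash$ be the syllogistic proof system with the following rules (premises $\Rightarrow$ conclusion), for all terms and verbs: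 - $\Rightarrow\forall(x,x)$; $\ \forall(x,y),\forall(y,z)\Rightarrow\forall(x,z)$; $\ \forall(x,y)\Rightarrow\forall(r\ \mathrm{all}\ y,\ r\ \mathrm{all}\ x)$; - $\exists(x,y)\Rightarrow\exists(x,x)$; $\ \exists(x,y)\Rightarrow\exists(y,x)$; $\ \exists(x,y),\forall(y,z)\Rightarrow\exists(x,z)$; - $\Rightarrow\forall(a,b)\vee\exists(a,a)$; $\ \Rightarrow\forall(b,\ r\ \mathrm{all}\ a)\vee\exists(a,a)$; - $\forall(a,b)\vee\exists(x,y)\Rightarrow\forall(a,b)\vee\exists(x,x)$; $\ \forall(a,b)\vee\exists(x,y)\Rightarrow\forall(a,b)\vee\exists(y,x)$; - $\forall(a,b)\Rightarrow\forall(a,b)\vee\exists(x,y)$; $\ \exists(x,y)\Rightarrow\forall(a,b)\vee\exists(x,y)$; - $\forall(a,b)\vee\exists(x,y),\ \forall(b,c)\vee\exists(x,y)\Rightarrow\forall(a,c)\vee\exists(x,y)$; - $\forall(a,b)\vee\exists(x,y)\Rightarrow\forall(r\ \mathrm{all}\ b,\ r\ \mathrm{all}\ a)\vee\exists(x,y)$;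 - $\exists(t,u),\ \forall(t,x)\vee\exists(x,y),\ \forall(u,y)\vee\exists(x,y)\Rightarrow\exists(x,y)$; - $\forall(a,b)\vee\exists(t,u),\ \forall(t,x)\vee\exists(x,y),\ \forall(u,y)\vee\exists(x,y)\Rightarrow\forall(a,b)\vee\exists(x,y)$. $\Gamma\vdash\phi$ means that there is a finite tree of sentences with root $\phi$ in which each node is a leaf belonging to $\Gamma$ or follows from its children by an instance of a rule; $\Gamma\vdash_A\phi$ means that there is such a tree all of whose sentences are in $A$. For a set $\Delta$ of sentences, let $T(\Delta)$ be the set of subterms of sentences in $\Delta$, let $T^+(\Delta)$ be $T(\Delta)$ together with the terms $(r\ \mathrm{all}\ w)$ with $w\in T(\Delta)$ and $r$ a verb occurring in $\Delta$, and let $g(\Delta)$ consist of the sentences $\forall(x,y)$, $\exists(u,v)$ and $\forall(x,y)\vee\exists(u,v)$ with $x,u,v\in T(\Delta)$ and $y\in T^+(\Delta)$. A syllogistic proof system for $\mathcal L_{1.5}^+$ is *boundedly complete* if it is sound and there is a polynomial-time computable map $f$ from finite sets of sentences to finite sets of sentences such that, for finite $\Gamma$, $\Gamma\models\phi$ implies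 $\Gamma\vdash_{f(\Gamma\cup\{\phi\})}\phi$. For computations, nouns and verbs are named by binary words (distinct nouns by distinct words, and distinct verbs by distinct words), and sentences and finite lists of sentences are written as words accordingly. **Theorem.** 1. The proof system is sound: $\Gamma\vdash\phi$ implies $\Gamma\models\phi$. 2. For every set $\Gamma$ of sentences of $\mathcal L_{1.5}^+$ and every sentence $\phi$: if $\Gamma\models\phi$, then $\Gamma\vdash_{g(\Gamma\cup\{\phi\})}\phi$. 3. On finite sets of sentences, $g$ is computable in polynomial time; hence the proof system is boundedly complete for $\mathcal L_{1.5}^+$. 4. The problem of deciding, given a finite set $\Gamma$ and a sentence $\phi$ of $\mathcal L_{1.5}^+$, whether $\Gamma\models\phi$, is in PTIME. The same holds for $\mathcal L_{1.5}$. -/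

import Mathlib

namespace Syllogistic

/-! ### Syntax -/

/-- Terms over a set `P` of nouns and a set `R` of verbs: nouns `p`, and `(r all x)`. -/
inductive Term (P R : Type) : Type
  | noun (p : P) : Term P R
  | rAll (r : R) (x : Term P R) : Term P R

/-- Sentences of the extended language: `all x y`, `some x y`, and the four-place sentence
`all a b or some x y`. -/
inductive Sentence (P R : Type) : Type
  | all (x y : Term P R) : Sentence P R
  | some (x y : Term P R) : Sentence P R
  | allOrSome (a b x y : Term P R) : Sentence P R

/-- Sentences of the smaller language, which has only `all x y` and `some x y`. -/
inductive BasicSentence (P R : Type) : Type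
  | all (x y : Term P R) : BasicSentence P R
  | some (x y : Term P R) : BasicSentence P R

/-- The inclusion of the smaller language in the extended one. -/
def BasicSentence.toSentence {P R : Type} : BasicSentence P R → Sentence P R
  | .all x y => .all x y
  | .some x y => .some x y

/-! ### Semantics -/

/-- A model: a set (possibly empty), a subset of it for each noun, and a binary relation on it
for each verb. -/
structure Model (P R : Type) where
  carrier : Type
  noun : P → Set carrier
  verb : R → carrier → carrier → Prop

/-- The interpretation of a term in a model. -/
def Model.interp {P R : Type} (M : Model P R) : Term P R → Set M.carrier
  | .noun p => M.noun p
  | .rAll r x => {m | ∀ n ∈ M.interp x, M.verb r m n}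

/-- Truth of a sentence in a model. -/
def Model.Sat {P R : Type} (M : Model P R) : Sentence P R → Prop
  | .all x y => M.interp x ⊆ M.interp y
  | .some x y => (M.interp x ∩ M.interp y).Nonempty
  | .allOrSome a b x y => M.interp a ⊆ M.interp b ∨ (M.interp x ∩ M.interp y).Nonempty

/-- Semantic consequence in the extended language: every model of `Γ` satisfies `φ`. -/
def Entails {P R : Type} (Γ : Set (Sentence P R)) (φ : Sentence P R) : Prop :=
  ∀ M : Model P R, (∀ ψ ∈ Γ, M.Sat ψ) → M.Sat φ

/-- Semantic consequence in the smaller language. -/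
def BasicEntails {P R : Type} (Γ : Set (BasicSentence P R)) (φ : BasicSentence P R) : Prop :=
  ∀ M : Model P R, (∀ ψ ∈ Γ, M.Sat ψ.toSentence) → M.Sat φ.toSentence

/-! ### Syllogistic proof systems -/

/-- Term templates, with noun variables in `N`, verb variables in `V`, term variables in `X`. -/
inductive TermTemplate (N V X : Type) : Type
  | var (x : X) : TermTemplate N V X
  | noun (n : N) : TermTemplate N V X
  | rAll (r : V) (t : TermTemplate N V X) : TermTemplate N V X

/-- Sentence templates; `S` is the set of sentence variables. -/
inductive SentenceTemplate (N V X S : Type) : Type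
  | var (s : S) : SentenceTemplate N V X S
  | all (x y : TermTemplate N V X) : SentenceTemplate N V X S
  | some (x y : TermTemplate N V X) : SentenceTemplate N V X S
  | allOrSome (a b x y : TermTemplate N V X) : SentenceTemplate N V X S

/-- A syllogistic rule: finitely many premises and a conclusion, all of them sentence templates.
The numbers of noun, verb, term and sentence variables of the rule are part of the data. -/
structure Rule where
  nouns : ℕ
  verbs : ℕ
  terms : ℕ
  sentences : ℕ
  premises : List (SentenceTemplate (Fin nouns) (Fin verbs) (Fin terms) (Fin sentences))
  conclusion : SentenceTemplate (Fin nouns) (Fin verbs) (Fin terms) (Fin sentences)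

/-- A substitution of nouns, verbs, terms and sentences for the variables of a rule. -/
structure Substitution (ρ : Rule) (P R : Type) where
  noun : Fin ρ.nouns → P
  verb : Fin ρ.verbs → R
  term : Fin ρ.terms → Term P R
  sentence : Fin ρ.sentences → Sentence P R

/-- The result of a substitution in a term template. -/
def Substitution.onTerm {ρ : Rule} {P R : Type} (σ : Substitution ρ P R) :
    TermTemplate (Fin ρ.nouns) (Fin ρ.verbs) (Fin ρ.terms) → Term P R
  | .var x => σ.term x
  | .noun n => .noun (σ.noun n)
  | .rAll r t => .rAll (σ.verb r) (σ.onTerm t)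

/-- The result of a substitution in a sentence template. -/
def Substitution.onSentence {ρ : Rule} {P R : Type} (σ : Substitution ρ P R) :
    SentenceTemplate (Fin ρ.nouns) (Fin ρ.verbs) (Fin ρ.terms) (Fin ρ.sentences) → Sentence P R
  | .var s => σ.sentence s
  | .all x y => .all (σ.onTerm x) (σ.onTerm y)
  | .some x y => .some (σ.onTerm x) (σ.onTerm y)
  | .allOrSome a b x y => .allOrSome (σ.onTerm a) (σ.onTerm b) (σ.onTerm x) (σ.onTerm y)

/-- `ProvesIn S A Γ φ`: there is a proof tree over `Γ` in the system `S` (a finite list of rules)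
with root `φ`, all of whose sentences belong to `A`. -/
inductive ProvesIn {P R : Type} (S : List Rule) (A Γ : Set (Sentence P R)) :
    Sentence P R → Prop
  | leaf {φ : Sentence P R} (hΓ : φ ∈ Γ) (hA : φ ∈ A) : ProvesIn S A Γ φ
  | node (ρ : Rule) (hρ : ρ ∈ S) (σ : Substitution ρ P R)
      (hprem : ∀ θ ∈ ρ.premises, ProvesIn S A Γ (σ.onSentence θ))
      (hA : σ.onSentence ρ.conclusion ∈ A) : ProvesIn S A Γ (σ.onSentence ρ.conclusion)

/-- Provability: there is a proof tree over `Γ` with root `φ`. -/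
def Proves {P R : Type} (S : List Rule) (Γ : Set (Sentence P R)) (φ : Sentence P R) : Prop :=
  ProvesIn S Set.univ Γ φ

/-- Soundness of a proof system, for the language over the nouns `P` and the verbs `R`. -/
def Sound (P R : Type) (S : List Rule) : Prop :=
  ∀ (Γ : Set (Sentence P R)) (φ : Sentence P R), Proves S Γ φ → Entails Γ φ

/-! ### The rules for the extended language -/

/-- `all x x`. -/
def ruleAxiom : Rule where
  nouns := 0
  verbs := 0
  terms := 1
  sentences := 0
  premises := []
  conclusion := .all (.var 0) (.var 0)

/-- From `all x y` and `all y z` infer `all x z`. -/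
def ruleBarbara : Rule where
  nouns := 0
  verbs := 0
  terms := 3
  sentences := 0
  premises := [.all (.var 0) (.var 1), .all (.var 1) (.var 2)]
  conclusion := .all (.var 0) (.var 2)

/-- From `all x y` infer `all (r all y) (r all x)`. -/
def ruleAnti : Rule where
  nouns := 0
  verbs := 1
  terms := 2
  sentences := 0
  premises := [.all (.var 0) (.var 1)]
  conclusion := .all (.rAll 0 (.var 1)) (.rAll 0 (.var 0))

/-- From `some x y` infer `some x x`. -/
def ruleSome1 : Rule where
  nouns := 0
  verbs := 0
  terms := 2
  sentences := 0
  premises := [.some (.var 0) (.var 1)]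
  conclusion := .some (.var 0) (.var 0)

/-- From `some x y` infer `some y x`. -/
def ruleSome2 : Rule where
  nouns := 0
  verbs := 0
  terms := 2
  sentences := 0
  premises := [.some (.var 0) (.var 1)]
  conclusion := .some (.var 1) (.var 0)

/-- From `some x y` and `all y z` infer `some x z`. -/
def ruleDarii : Rule where
  nouns := 0
  verbs := 0
  terms := 3
  sentences := 0
  premises := [.some (.var 0) (.var 1), .all (.var 1) (.var 2)]
  conclusion := .some (.var 0) (.var 2)

/-- `all a b or some a a`. -/
def ruleEmpty1 : Rule where
  nouns := 0
  verbs := 0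
  terms := 2
  sentences := 0
  premises := []
  conclusion := .allOrSome (.var 0) (.var 1) (.var 0) (.var 0)

/-- `all b (r all a) or some a a`. -/
def ruleEmpty2 : Rule where
  nouns := 0
  verbs := 1
  terms := 2
  sentences := 0
  premises := []
  conclusion := .allOrSome (.var 1) (.rAll 0 (.var 0)) (.var 0) (.var 0)

/-- From `all a b or some x y` infer `all a b or some x x`. -/
def ruleOrSome1 : Rule where
  nouns := 0
  verbs := 0
  terms := 4
  sentences := 0
  premises := [.allOrSome (.var 0) (.var 1) (.var 2) (.var 3)]
  conclusion := .allOrSome (.var 0) (.var 1) (.var 2) (.var 2)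

/-- From `all a b or some x y` infer `all a b or some y x`. -/
def ruleOrSome2 : Rule where
  nouns := 0
  verbs := 0
  terms := 4
  sentences := 0
  premises := [.allOrSome (.var 0) (.var 1) (.var 2) (.var 3)]
  conclusion := .allOrSome (.var 0) (.var 1) (.var 3) (.var 2)

/-- From `all a b` infer `all a b or some x y`. -/
def ruleLeftWeakening : Rule where
  nouns := 0
  verbs := 0
  terms := 4
  sentences := 0
  premises := [.all (.var 0) (.var 1)]
  conclusion := .allOrSome (.var 0) (.var 1) (.var 2) (.var 3)

/-- From `some x y` infer `all a b or some x y`. -/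
def ruleRightWeakening : Rule where
  nouns := 0
  verbs := 0
  terms := 4
  sentences := 0
  premises := [.some (.var 2) (.var 3)]
  conclusion := .allOrSome (.var 0) (.var 1) (.var 2) (.var 3)

/-- From `all a b or some x y` and `all b c or some x y` infer `all a c or some x y`.
Here `a`, `b`, `c`, `x`, `y` are the variables 0, 1, 2, 3, 4. -/
def ruleOrBarbara : Rule where
  nouns := 0
  verbs := 0
  terms := 5
  sentences := 0
  premises := [.allOrSome (.var 0) (.var 1) (.var 3) (.var 4),
    .allOrSome (.var 1) (.var 2) (.var 3) (.var 4)]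
  conclusion := .allOrSome (.var 0) (.var 2) (.var 3) (.var 4)

/-- From `all a b or some x y` infer `all (r all b) (r all a) or some x y`. -/
def ruleOrAnti : Rule where
  nouns := 0
  verbs := 1
  terms := 4
  sentences := 0
  premises := [.allOrSome (.var 0) (.var 1) (.var 2) (.var 3)]
  conclusion := .allOrSome (.rAll 0 (.var 1)) (.rAll 0 (.var 0)) (.var 2) (.var 3)

/-- From `some t u`, `all t x or some x y` and `all u y or some x y` infer `some x y`.
Here `t`, `u`, `x`, `y` are the variables 0, 1, 2, 3. -/
def ruleDoubleDarii : Rule where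
  nouns := 0
  verbs := 0
  terms := 4
  sentences := 0
  premises := [.some (.var 0) (.var 1),
    .allOrSome (.var 0) (.var 2) (.var 2) (.var 3),
    .allOrSome (.var 1) (.var 3) (.var 2) (.var 3)]
  conclusion := .some (.var 2) (.var 3)

/-- From `all a b or some t u`, `all t x or some x y` and `all u y or some x y`
infer `all a b or some x y`.
Here `a`, `b`, `t`, `u`, `x`, `y` are the variables 0, 1, 2, 3, 4, 5. -/
def ruleOrDoubleDarii : Rule where
  nouns := 0
  verbs := 0
  terms := 6
  sentences := 0
  premises := [.allOrSome (.var 0) (.var 1) (.var 2) (.var 3),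
    .allOrSome (.var 2) (.var 4) (.var 4) (.var 5),
    .allOrSome (.var 3) (.var 5) (.var 4) (.var 5)]
  conclusion := .allOrSome (.var 0) (.var 1) (.var 4) (.var 5)

/-- The proof system for the extended language. -/
def extendedSystem : List Rule :=
  [ruleAxiom, ruleBarbara, ruleAnti, ruleSome1, ruleSome2, ruleDarii,
    ruleEmpty1, ruleEmpty2, ruleOrSome1, ruleOrSome2, ruleLeftWeakening, ruleRightWeakening,
    ruleOrBarbara, ruleOrAnti, ruleDoubleDarii, ruleOrDoubleDarii]

/-! ### The set `g Δ` -/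

/-- The subterms of a term (the term itself included). -/
def Term.subterms {P R : Type} : Term P R → Set (Term P R)
  | .noun p => {.noun p}
  | .rAll r x => insert (.rAll r x) x.subterms

/-- The terms which are immediate constituents of a sentence. -/
def Sentence.constituents {P R : Type} : Sentence P R → Set (Term P R)
  | .all x y => {x, y}
  | .some x y => {x, y}
  | .allOrSome a b x y => {a, b, x, y}

/-- `T(Δ)`: the subterms of sentences in `Δ`. -/
def subtermsOf {P R : Type} (Δ : Set (Sentence P R)) : Set (Term P R) :=
  {t | ∃ ψ ∈ Δ, ∃ x ∈ ψ.constituents, t ∈ x.subterms}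

/-- The verbs which occur in `Δ`. -/
def verbsOf {P R : Type} (Δ : Set (Sentence P R)) : Set R :=
  {r | ∃ x, Term.rAll r x ∈ subtermsOf Δ}

/-- `T⁺(Δ)`: `T(Δ)` together with the terms `(r all w)`, for `w` in `T(Δ)` and `r` a verb which
occurs in `Δ`. -/
def subtermsPlusOf {P R : Type} (Δ : Set (Sentence P R)) : Set (Term P R) :=
  subtermsOf Δ ∪ {t | ∃ r ∈ verbsOf Δ, ∃ w ∈ subtermsOf Δ, t = .rAll r w}

/-- `g(Δ)`: the sentences `all x y`, `some u v` and `all x y or some u v` with `x`, `u`, `v` in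
`T(Δ)` and `y` in `T⁺(Δ)`. -/
def g {P R : Type} (Δ : Set (Sentence P R)) : Set (Sentence P R) :=
  {ψ | (∃ x ∈ subtermsOf Δ, ∃ y ∈ subtermsPlusOf Δ, ψ = .all x y) ∨
    (∃ u ∈ subtermsOf Δ, ∃ v ∈ subtermsOf Δ, ψ = .some u v) ∨
    (∃ x ∈ subtermsOf Δ, ∃ y ∈ subtermsPlusOf Δ, ∃ u ∈ subtermsOf Δ, ∃ v ∈ subtermsOf Δ,
      ψ = .allOrSome x y u v)}

/-! ### Polynomial time

Nouns and verbs are named by binary strings, through injections `codeP` and `codeR`. Computations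
are on words over a finite alphabet, by the multi-stack Turing machines of Mathlib. -/

/-- The finite alphabet in which inputs and outputs are written. -/
inductive Letter : Type
  | bit (b : Bool)
  | endMark
  | noun
  | verb
  | all
  | some
  | allOrSome
  | turnstile

/-- The name of a noun or a verb, with an end marker. -/
def encodeName (w : List Bool) : List Letter :=
  w.map Letter.bit ++ [Letter.endMark]

/-- Terms as words (in prefix notation). -/
def encodeTerm {P R : Type} (codeP : P → List Bool) (codeR : R → List Bool) :
    Term P R → List Letter
  | .noun p => Letter.noun :: encodeName (codeP p)
  | .rAll r x => Letter.verb :: (encodeName (codeR r) ++ encodeTerm codeP codeR x)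

/-- Sentences as words (in prefix notation). -/
def encodeSentence {P R : Type} (codeP : P → List Bool) (codeR : R → List Bool) :
    Sentence P R → List Letter
  | .all x y => Letter.all :: (encodeTerm codeP codeR x ++ encodeTerm codeP codeR y)
  | .some x y => Letter.some :: (encodeTerm codeP codeR x ++ encodeTerm codeP codeR y)
  | .allOrSome a b x y => Letter.allOrSome ::
      (encodeTerm codeP codeR a ++ encodeTerm codeP codeR b ++
        encodeTerm codeP codeR x ++ encodeTerm codeP codeR y)

/-- A finite list of sentences (presenting a finite theory), as a word. -/
def encodeTheory {P R : Type} (codeP : P → List Bool) (codeR : R → List Bool)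
    (L : List (Sentence P R)) : List Letter :=
  L.flatMap (encodeSentence codeP codeR)

/-- An instance of the consequence problem: a finite theory and a sentence. -/
def encodeQuery {P R : Type} (codeP : P → List Bool) (codeR : R → List Bool)
    (q : List (Sentence P R) × Sentence P R) : List Letter :=
  encodeTheory codeP codeR q.1 ++ Letter.turnstile :: encodeSentence codeP codeR q.2

/-- An instance of the consequence problem of the smaller language. -/
def encodeBasicQuery {P R : Type} (codeP : P → List Bool) (codeR : R → List Bool)
    (q : List (BasicSentence P R) × BasicSentence P R) : List Letter :=
  encodeQuery codeP codeR (q.1.map BasicSentence.toSentence, q.2.toSentence)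

/-- A decision problem on inputs in `α`, written as words by `enc`, is in PTIME. -/
def InPTime {α : Type} (enc : α → List Letter) (problem : α → Prop) : Prop :=
  Nonempty (Turing.TM2ComputableInPolyTime enc Computability.encodeBool
    (fun a => @decide (problem a) (Classical.propDecidable (problem a))))

/-- On finite sets of sentences, `f` is computable in polynomial time: some polynomial-time
machine transforms every list which presents a finite set `Δ` into a list which presents `f Δ`
(so in particular `f Δ` is finite). -/
def PTimeSetFunction {P R : Type} (codeP : P → List Bool) (codeR : R → List Bool)
    (f : Set (Sentence P R) → Set (Sentence P R)) : Prop :=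
  ∃ F : List (Sentence P R) → List (Sentence P R),
    (∀ L, {ψ | ψ ∈ F L} = f {ψ | ψ ∈ L}) ∧
    Nonempty (Turing.TM2ComputableInPolyTime (encodeTheory codeP codeR)
      (encodeTheory codeP codeR) F)

/-- `S` is a boundedly complete syllogistic proof system for the extended language. -/
def BoundedlyComplete {P R : Type} (codeP : P → List Bool) (codeR : R → List Bool)
    (S : List Rule) : Prop :=
  Sound P R S ∧
  ∃ f : Set (Sentence P R) → Set (Sentence P R), PTimeSetFunction codeP codeR f ∧
    ∀ (Γ : Set (Sentence P R)) (φ : Sentence P R), Γ.Finite → Entails Γ φ →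
      ProvesIn S (f (insert φ Γ)) Γ φ

end Syllogistic

namespace Syllogistic

/-! ### Structured programs on stacks -/

/-! Completeness comes from a canonical model whose elements are pairs of terms. Let the conclusion
have the existential disjunct `some x y`, and write a ≤ b when `all a b or some x y` has a proof
inside `g Δ`. A pair (u, v) of subterms stands for a generic common instance of u and v, and it
belongs to a term t when u ≤ t or v ≤ t. A pair is excluded when it is `Bad`, that is, when each of
x and y lies above u or above v, for such an element would make `some x y` true.

The truth lemma `Saturated.mem_interp` says that terms are interpreted in this way throughout. Its
critical case is `r all t`. If (t, t) is an element, it is the instance of t on which everything can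
be tested; if it is bad, then t is empty and the rule for empty terms puts every term below `r all
t`. Consequently `all a b` holds in the model exactly when a ≤ b, and `some u v` exactly when (u, v)
is not bad (`Saturated.sat_all`, `Saturated.sat_some`). The double Darii rules convert a premise
with a bad existential disjunct into a proof of `some x y`, or of its universal disjunct
alternatively to `some x y`. So either `some x y` is provable or the model satisfies all premises.
For a conclusion `all a b` no pair is forbidden, and all existential sentences over the given terms
hold.

The decision procedure uses the same model. Assuming that the existential disjunct of the conclusion
fails, the valid inclusions between subterms are generated by iterating a monotone one-step
deduction. Every stage is a sublist of the list of all pairs of subterms, so the iteration is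
stationary after as many rounds as there are pairs. The result is `Saturated`, hence has a canonical
model, which serves as countermodel whenever the test fails (`answer_eq_true`).

For polynomial time, structured programs over stacks are compiled to machines. Data are binary trees
in prefix notation, and `FP` is the class of functions computed on such codes in polynomial time. It
is closed under composition, pairing, case distinction and folds with polynomially bounded
accumulators; a parser that is itself such a fold gives access to the input. -/

noncomputable instance : DecidableEq Letter := Classical.decEq _

noncomputable instance : Fintype Letter :=
  Fintype.ofSurjective
    (fun i : Bool ⊕ Fin 7 => match i with
      | .inl b => Letter.bit b
      | .inr 0 => .endMark
      | .inr 1 => .noun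
      | .inr 2 => .verb
      | .inr 3 => .all
      | .inr 4 => .some
      | .inr 5 => .allOrSome
      | .inr 6 => .turnstile)
    (by
      rintro (b | _ | _ | _ | _ | _ | _ | _)
      exacts [⟨.inl b, rfl⟩, ⟨.inr 0, rfl⟩, ⟨.inr 1, rfl⟩, ⟨.inr 2, rfl⟩, ⟨.inr 3, rfl⟩,
        ⟨.inr 4, rfl⟩, ⟨.inr 5, rfl⟩, ⟨.inr 6, rfl⟩])

/-- The work stacks. -/
inductive Wk : Type
  | main | ret | buf | aux | cnt
  deriving DecidableEq

instance : Fintype Wk where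
  elems := {.main, .ret, .buf, .aux, .cnt}
  complete := by intro k; cases k <;> simp

/-- The stacks of our machines: the input, two possible outputs, and the work stacks. -/
inductive Stk : Type
  | inp | outW | outB
  | wk (w : Wk)
  deriving DecidableEq

noncomputable instance : Fintype Stk :=
  Fintype.ofSurjective
    (fun i : Wk ⊕ Fin 3 => match i with
      | .inl w => Stk.wk w
      | .inr 0 => .inp
      | .inr 1 => .outW
      | .inr 2 => .outB)
    (by
      rintro (_ | _ | _ | w)
      exacts [⟨.inr 0, rfl⟩, ⟨.inr 1, rfl⟩, ⟨.inr 2, rfl⟩, ⟨.inl w, rfl⟩])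

/-- The symbols on each of the stacks. -/
abbrev Stk.Sym : Stk → Type
  | .inp => Letter
  | .outW => Letter
  | .outB => Bool
  | .wk _ => Option Letter

noncomputable instance (k : Stk) : Fintype k.Sym := by
  cases k <;> (dsimp only [Stk.Sym]; infer_instance)

/-- The contents of all stacks. -/
abbrev Store : Type := ∀ k : Stk, List k.Sym

/-- Structured programs. -/
inductive Prog : Type
  | skip : Prog
  | push (k : Stk) (a : k.Sym) : Prog
  | pop (k : Stk) : Prog
  | seq (c d : Prog) : Prog
  | case (k : Stk) (f : Option k.Sym → Prog) : Prog
  | loop (k : Stk) (p : Option k.Sym → Bool) (c : Prog) : Prog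

/-- `Run c S t S'`: the program `c` transforms `S` into `S'` in `t` steps. -/
inductive Run : Prog → Store → ℕ → Store → Prop
  | skip (S : Store) : Run .skip S 1 S
  | push (k : Stk) (a : k.Sym) (S : Store) :
      Run (.push k a) S 1 (Function.update S k (a :: S k))
  | pop (k : Stk) (S : Store) : Run (.pop k) S 1 (Function.update S k (S k).tail)
  | seq {c d : Prog} {S S' S'' : Store} {t t' : ℕ} (h : Run c S t S') (h' : Run d S' t' S'') :
      Run (.seq c d) S (t + t') S''
  | case {k : Stk} {f : Option k.Sym → Prog} {S S' : Store} {t : ℕ}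
      (h : Run (f (S k).head?) S t S') : Run (.case k f) S (1 + t) S'
  | loopDone {k : Stk} {p : Option k.Sym → Bool} {c : Prog} {S : Store}
      (hp : p (S k).head? = false) : Run (.loop k p c) S 1 S
  | loopStep {k : Stk} {p : Option k.Sym → Bool} {c : Prog} {S S' S'' : Store} {t t' : ℕ}
      (hp : p (S k).head? = true) (h : Run c S t S') (h' : Run (.loop k p c) S' t' S'') :
      Run (.loop k p c) S (1 + (t + t')) S''

/-- A program lengthens the main stack by at most one symbol per step. -/
theorem Run.length_main_le {c : Prog} {S S' : Store} {t : ℕ} (h : Run c S t S') :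
    (S' (.wk .main)).length ≤ (S (.wk .main)).length + t := by
  induction h with
  | skip S => omega
  | push k a S =>
    by_cases hk : k = .wk .main
    · subst hk; simp
    · rw [Function.update_of_ne (Ne.symm hk)]; omega
  | pop k S =>
    by_cases hk : k = .wk .main
    · subst hk; simp; omega
    · rw [Function.update_of_ne (Ne.symm hk)]; omega
  | seq _ _ ih ih' => omega
  | case _ ih => omega
  | loopDone _ => omega
  | loopStep _ _ _ ih ih' => omega

/-! ### Compilation of programs to machines -/

/-- The labels of the machine code of a program. -/
def Prog.Lab : Prog → Type
  | .skip => Unit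
  | .push _ _ => Unit
  | .pop _ => Unit
  | .seq c d => c.Lab ⊕ d.Lab
  | .case _ f => Option (Σ a, (f a).Lab)
  | .loop _ _ c => Option c.Lab

instance Prog.finite_lab (c : Prog) : Finite c.Lab := by
  induction c with
  | skip | push | pop => exact inferInstanceAs (Finite Unit)
  | seq c d hc hd => exact inferInstanceAs (Finite (c.Lab ⊕ d.Lab))
  | case k f hf => exact inferInstanceAs (Finite (Option (Σ a, (f a).Lab)))
  | loop k p c hc => exact inferInstanceAs (Finite (Option c.Lab))

/-- The label where the execution starts. -/
def Prog.entry : (c : Prog) → c.Lab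
  | .skip => ()
  | .push _ _ => ()
  | .pop _ => ()
  | .seq c _ => Sum.inl c.entry
  | .case _ _ => Option.none
  | .loop _ _ _ => Option.none

/-- The internal states: for each stack, the symbol which was last seen on it. -/
abbrev Memory : Type := ∀ k : Stk, Option k.Sym

/-- The machine code of a program; `e` places its labels, `exit` is where to go at the end. -/
def Prog.stmt {Λ : Type} : (c : Prog) → (e : c.Lab → Λ) → (exit : Λ) → c.Lab →
    Turing.TM2.Stmt Stk.Sym Λ Memory
  | .skip, _, exit => fun _ => .goto fun _ => exit
  | .push k a, _, exit => fun _ => .push k (fun _ => a) (.goto fun _ => exit)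
  | .pop k, _, exit => fun _ => .pop k (fun v _ => v) (.goto fun _ => exit)
  | .seq c d, e, exit => Sum.elim (c.stmt (fun l => e (Sum.inl l)) (e (Sum.inr d.entry)))
      (d.stmt (fun l => e (Sum.inr l)) exit)
  | .case k f, e, exit => fun l => match l with
      | Option.none => .peek k (fun v s => Function.update v k s)
          (.goto fun v => e (Option.some ⟨v k, (f (v k)).entry⟩))
      | Option.some ⟨a, l⟩ => (f a).stmt (fun l => e (Option.some ⟨a, l⟩)) exit l
  | .loop k p c, e, exit => fun l => match l with
      | Option.none => .peek k (fun v s => Function.update v k s)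
          (.branch (fun v => p (v k)) (.goto fun _ => e (Option.some c.entry))
            (.goto fun _ => exit))
      | Option.some l => c.stmt (fun l => e (Option.some l)) (e Option.none) l

/-- Iterated steps of a machine. -/
abbrev stepsTo {Λ : Type} (M : Λ → Turing.TM2.Stmt Stk.Sym Λ Memory) (t : ℕ)
    (x y : Turing.TM2.Cfg Stk.Sym Λ Memory) : Prop :=
  (flip bind (Turing.TM2.step M))^[t] (Option.some x) = Option.some y

theorem stepsTo_trans {Λ : Type} {M : Λ → Turing.TM2.Stmt Stk.Sym Λ Memory} {t t' : ℕ}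
    {x y z : Turing.TM2.Cfg Stk.Sym Λ Memory} (h : stepsTo M t x y) (h' : stepsTo M t' y z) :
    stepsTo M (t + t') x z := by
  rw [stepsTo, Nat.add_comm, Function.iterate_add_apply, h, h']

theorem stepsTo_one {Λ : Type} {M : Λ → Turing.TM2.Stmt Stk.Sym Λ Memory} {l : Λ} {v : Memory}
    {S : Store} {s : Turing.TM2.Stmt Stk.Sym Λ Memory} (h : M l = s) :
    stepsTo M 1 ⟨Option.some l, v, S⟩ (Turing.TM2.stepAux s v S) := by
  subst h; rfl

/-- By induction on the run. The memory `v` can be arbitrary because each test first peeks at the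
stack that it inspects and overwrites what was remembered of it. The exit varies in the induction,
since a loop body exits to the head of its loop and the first half of a sequence to the entry of the
second. -/
theorem Run.stepsTo {c : Prog} {S S' : Store} {t : ℕ} (h : Run c S t S') {Λ : Type}
    {M : Λ → Turing.TM2.Stmt Stk.Sym Λ Memory} {e : c.Lab → Λ} {exit : Λ}
    (hM : ∀ l, M (e l) = c.stmt e exit l) (v : Memory) :
    ∃ v', stepsTo M t ⟨Option.some (e c.entry), v, S⟩ ⟨Option.some exit, v', S'⟩ := by
  induction h generalizing v exit with
  | skip S => exact ⟨v, stepsTo_one (hM ())⟩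
  | push k a S => exact ⟨v, stepsTo_one (hM ())⟩
  | pop k S => exact ⟨v, stepsTo_one (hM ())⟩
  | @seq c d S S' S'' t t' _ _ ih ih' =>
    obtain ⟨v₁, h₁⟩ := ih (e := fun l => e (Sum.inl l)) (fun l => hM (Sum.inl l)) v
    obtain ⟨v₂, h₂⟩ := ih' (e := fun l => e (Sum.inr l)) (fun l => hM (Sum.inr l)) v₁
    exact ⟨v₂, stepsTo_trans h₁ h₂⟩
  | @case k f S S' t _ ih =>
    have h₁ := stepsTo_one (v := v) (S := S) (hM Option.none)
    simp only [Prog.stmt, Turing.TM2.stepAux] at h₁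
    rw [Function.update_self k] at h₁
    obtain ⟨v₂, h₂⟩ := ih (e := fun l => e (Option.some ⟨_, l⟩)) (exit := exit)
      (fun l => (hM (Option.some ⟨_, l⟩)).trans (by rw [Prog.stmt]))
      (Function.update v k (S k).head?)
    exact ⟨v₂, stepsTo_trans h₁ h₂⟩
  | @loopDone k p c S hp =>
    have h₁ := stepsTo_one (v := v) (S := S) (hM Option.none)
    simp only [Prog.stmt, Turing.TM2.stepAux, Function.update_self, hp, cond_false] at h₁
    exact ⟨_, h₁⟩
  | @loopStep k p c S S' S'' t t' hp _ _ ih ih' =>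
    have h₁ := stepsTo_one (v := v) (S := S) (hM Option.none)
    simp only [Prog.stmt, Turing.TM2.stepAux, Function.update_self, hp, cond_true] at h₁
    obtain ⟨v₂, h₂⟩ := ih (e := fun l => e (Option.some l)) (fun l => hM (Option.some l))
      (Function.update v k (S k).head?)
    obtain ⟨v₃, h₃⟩ := ih' hM v₂
    exact ⟨v₃, stepsTo_trans h₁ (stepsTo_trans h₂ h₃)⟩

/-- The machine which runs a program and halts. -/
noncomputable def Prog.machine (c : Prog) (k₀ k₁ : Stk) : Turing.FinTM2 where
  K := Stk
  k₀ := k₀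
  k₁ := k₁
  Γ := Stk.Sym
  Λ := Option c.Lab
  main := Option.some c.entry
  ΛFin := Fintype.ofFinite _
  σ := Memory
  initialState := fun _ => Option.none
  m := fun l => match l with
    -- `Turing.haltList` requires the initial internal state, so the memory is cleared. This is the
    -- one extra step counted in `Run.evalsTo`.
    | Option.none => .load (fun _ _ => Option.none) .halt
    | Option.some l => c.stmt Option.some Option.none l

/-- The store with only the stack `k` nonempty. -/
def single (k : Stk) (l : List k.Sym) : Store := Function.update (fun _ => []) k l

theorem Run.evalsTo {c : Prog} {k₀ k₁ : Stk} {l : List k₀.Sym} {l' : List k₁.Sym} {t : ℕ}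
    (h : Run c (single k₀ l) t (single k₁ l')) :
    (flip bind (c.machine k₀ k₁).step)^[t + 1]
        (Option.some (Turing.initList (c.machine k₀ k₁) l)) =
      Option.some (Turing.haltList (c.machine k₀ k₁) l') := by
  have hs : ∀ (k : Stk) (l : List k.Sym), single k l = fun k' =>
      @dite (List k'.Sym) (k' = k) (instDecidableEqStk k' k) (fun h => by rw [h]; exact l)
        fun _ => [] := by
    intro k l
    funext k'
    by_cases hk : k' = k
    · subst hk; simp [single]
    · simp [single, hk]
  obtain ⟨v, hv⟩ := h.stepsTo (M := (c.machine k₀ k₁).m) (e := Option.some)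
    (exit := Option.none) (fun l => rfl) (fun _ => Option.none)
  have h₂ := stepsTo_trans hv (stepsTo_one (M := (c.machine k₀ k₁).m) (l := Option.none) (v := v)
    (S := single k₁ l') (s := .load (fun _ _ => Option.none) .halt) rfl)
  rw [hs, hs] at h₂
  exact h₂

theorem polyTime_of_run {α β αΓ βΓ : Type} {ea : α → List αΓ} {eb : β → List βΓ} {f : α → β}
    (c : Prog) (k₀ k₁ : Stk) (e₀ : k₀.Sym ≃ αΓ) (e₁ : k₁.Sym ≃ βΓ) (p : Polynomial ℕ)
    (h : ∀ a, ∃ t ≤ p.eval (ea a).length, Run c (single k₀ ((ea a).map e₀.symm)) t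
      (single k₁ ((eb (f a)).map e₁.symm))) :
    Nonempty (Turing.TM2ComputableInPolyTime ea eb f) := by
  choose t ht hr using h
  exact ⟨{
    tm := c.machine k₀ k₁
    inputAlphabet := e₀
    outputAlphabet := e₁
    time := p + 1
    outputsFun := fun a =>
      { steps := t a + 1
        evals_in_steps := (hr a).evalsTo
        steps_le_m := by simpa using ht a } }⟩

end Syllogistic

namespace Syllogistic

/-! ### Binary trees on the work stacks -/

/-- Binary trees with letters at the leaves. -/
inductive BTree : Type
  | leaf (a : Letter) : BTree
  | node (x y : BTree) : BTree

/-- A tree in prefix notation; the symbol `none` stands for an inner node. -/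
def BTree.word : BTree → List (Option Letter)
  | .leaf a => [Option.some a]
  | .node x y => Option.none :: (x.word ++ y.word)

/-- The length of the prefix notation. -/
def BTree.size (x : BTree) : ℕ := x.word.length

@[simp] theorem BTree.size_leaf (a : Letter) : (BTree.leaf a).size = 1 := rfl

@[simp] theorem BTree.size_node (x y : BTree) : (BTree.node x y).size = x.size + y.size + 1 := by
  simp [size, word]

theorem BTree.one_le_size (x : BTree) : 1 ≤ x.size := by
  cases x <;> simp

/-- The prefix notation of a tree determines where it ends. The tails `m` and `m'` let the induction
pass from the first subtree to the second. -/
theorem BTree.word_append_inj {x : BTree} : ∀ {y : BTree} {m m' : List (Option Letter)},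
    x.word ++ m = y.word ++ m' → x = y ∧ m = m' := by
  induction x with
  | leaf a => intro y m m' h; cases y <;> simp_all [word]
  | node x₁ x₂ ih₁ ih₂ =>
    intro y m m' h
    cases y with
    | leaf a => simp [word] at h
    | node y₁ y₂ =>
      simp only [word, List.cons_append, List.append_assoc, List.cons.injEq, true_and] at h
      obtain ⟨h₁, h⟩ := ih₁ h
      obtain ⟨h₂, h⟩ := ih₂ h
      exact ⟨by rw [h₁, h₂], h⟩

theorem BTree.word_inj {x y : BTree} : x.word = y.word ↔ x = y :=
  ⟨fun h => (word_append_inj (m := []) (m' := []) (by simpa using h)).1, fun h => h ▸ rfl⟩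

/-- The store in which only work stacks are nonempty. -/
def st (f : Wk → List (Option Letter)) : Store
  | .wk w => f w
  | .inp => []
  | .outW => []
  | .outB => []

/-- The contents of the work stacks, listed. -/
def wk (m r b a c : List (Option Letter)) : Wk → List (Option Letter)
  | .main => m
  | .ret => r
  | .buf => b
  | .aux => a
  | .cnt => c

section
variable (m r b a c l : List (Option Letter))

@[simp] theorem wk_main : wk m r b a c .main = m := rfl
@[simp] theorem wk_ret : wk m r b a c .ret = r := rfl
@[simp] theorem wk_buf : wk m r b a c .buf = b := rfl
@[simp] theorem wk_aux : wk m r b a c .aux = a := rfl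
@[simp] theorem wk_cnt : wk m r b a c .cnt = c := rfl

@[simp] theorem update_wk_main : Function.update (wk m r b a c) .main l = wk l r b a c := by
  funext w; cases w <;> rfl
@[simp] theorem update_wk_ret : Function.update (wk m r b a c) .ret l = wk m l b a c := by
  funext w; cases w <;> rfl
@[simp] theorem update_wk_buf : Function.update (wk m r b a c) .buf l = wk m r l a c := by
  funext w; cases w <;> rfl
@[simp] theorem update_wk_aux : Function.update (wk m r b a c) .aux l = wk m r b l c := by
  funext w; cases w <;> rfl
@[simp] theorem update_wk_cnt : Function.update (wk m r b a c) .cnt l = wk m r b a l := by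
  funext w; cases w <;> rfl

end

theorem update_st (f : Wk → List (Option Letter)) (w : Wk) (l : List (Option Letter)) :
    Function.update (st f) (.wk w) l = st (Function.update f w l) := by
  funext k
  cases k with
  | wk w' =>
    by_cases h : w' = w
    · subst h; simp [st]
    · have h' : Stk.wk w' ≠ Stk.wk w := fun h' => h (Stk.wk.inj h')
      rw [Function.update_of_ne h']
      simp [st, h]
  | inp | outW | outB => rw [Function.update_of_ne (by simp)]; rfl

/-- `Runs c S S' n`: the program `c` transforms `S` into `S'` in at most `n` steps. -/
def Runs (c : Prog) (S S' : Store) (n : ℕ) : Prop := ∃ t ≤ n, Run c S t S'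

namespace Runs

variable {c d : Prog} {S S' S'' : Store} {n n' : ℕ}

theorem mono (h : Runs c S S' n) (hn : n ≤ n') : Runs c S S' n' :=
  let ⟨t, ht, hr⟩ := h
  ⟨t, ht.trans hn, hr⟩

theorem congr (h : Runs c S S' n) (hS : S' = S'') : Runs c S S'' n := hS ▸ h

theorem start (h : Runs c S S' n) (hS : S'' = S) : Runs c S'' S' n := hS ▸ h

theorem seq (h : Runs c S S' n) (h' : Runs d S' S'' n') : Runs (.seq c d) S S'' (n + n') :=
  let ⟨_, ht, hr⟩ := h
  let ⟨_, ht', hr'⟩ := h'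
  ⟨_, Nat.add_le_add ht ht', hr.seq hr'⟩

theorem skip : Runs .skip S S 1 := ⟨1, le_rfl, .skip S⟩

theorem push_wk (f : Wk → List (Option Letter)) (w : Wk) (a : Option Letter) :
    Runs (.push (.wk w) a) (st f) (st (Function.update f w (a :: f w))) 1 :=
  ⟨1, le_rfl, update_st f w _ ▸ Run.push (.wk w) a (st f)⟩

theorem pop_wk (f : Wk → List (Option Letter)) (w : Wk) :
    Runs (.pop (.wk w)) (st f) (st (Function.update f w (f w).tail)) 1 :=
  ⟨1, le_rfl, update_st f w _ ▸ Run.pop (.wk w) (st f)⟩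

theorem case {k : Stk} {f : Option k.Sym → Prog} (h : Runs (f (S k).head?) S S' n) :
    Runs (.case k f) S S' (1 + n) :=
  let ⟨_, ht, hr⟩ := h
  ⟨_, Nat.add_le_add le_rfl ht, hr.case⟩

theorem loopDone {k : Stk} {p : Option k.Sym → Bool} (hp : p (S k).head? = false) :
    Runs (.loop k p c) S S 1 := ⟨1, le_rfl, .loopDone hp⟩

theorem loopStep {k : Stk} {p : Option k.Sym → Bool} (hp : p (S k).head? = true)
    (h : Runs c S S' n) (h' : Runs (.loop k p c) S' S'' n') :
    Runs (.loop k p c) S S'' (1 + (n + n')) :=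
  let ⟨_, ht, hr⟩ := h
  let ⟨_, ht', hr'⟩ := h'
  ⟨_, by omega, hr.loopStep hp hr'⟩

theorem case_wk {f : Wk → List (Option Letter)} {w : Wk} {g : Option (Option Letter) → Prog}
    {o : Option (Option Letter)} (ho : (f w).head? = o) (h : Runs (g o) (st f) S' n) :
    Runs (.case (.wk w) g) (st f) S' (1 + n) := by
  subst ho
  exact Runs.case h

end Runs

/-- Move one symbol of a tree from the stack `s` to the stack `aux`. -/
def unloadBody (s : Wk) : Prog :=
  .case (.wk s) fun o => match o with
    | Option.none => .skip
    | Option.some Option.none => .seq (.pop (.wk s))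
        (.seq (.push (.wk .aux) Option.none) (.push (.wk .cnt) Option.none))
    | Option.some (Option.some a) => .seq (.pop (.wk s))
        (.seq (.push (.wk .aux) (Option.some a)) (.pop (.wk .cnt)))

/-- Move trees from the stack `s` to the stack `aux`, in reverse, until `cnt` is empty. -/
def unloadLoop (s : Wk) : Prog := .loop (.wk .cnt) Option.isSome (unloadBody s)

/-- Move one tree from the stack `s` to the stack `aux`, in reverse. -/
def unload (s : Wk) : Prog := .seq (.push (.wk .cnt) Option.none) (unloadLoop s)

/-- `cnt` holds one mark for each tree still to be read: a leaf removes a mark, an inner node adds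
one because two trees replace one. The rest of the run is a hypothesis, so that the second subtree
is handled as the continuation of the first. Each symbol costs five steps. -/
theorem runs_unloadLoop {s : Wk} (ha : s ≠ .aux) (hc : s ≠ .cnt) (x : BTree) :
    ∀ {f : Wk → List (Option Letter)} {m c : List (Option Letter)} {S : Store} {n : ℕ},
      f s = x.word ++ m → f .cnt = Option.none :: c →
      Runs (unloadLoop s) (st (Function.update (Function.update (Function.update f s m)
        .aux (x.word.reverse ++ f .aux)) .cnt c)) S n →
      Runs (unloadLoop s) (st f) S (5 * x.size + n) := by
  induction x with
  | leaf a =>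
    intro f m c S n hs hcnt h
    have h₁ := (Runs.pop_wk f s).seq ((Runs.push_wk _ .aux (Option.some a)).seq
      (Runs.pop_wk _ .cnt))
    have h₂ : Runs (unloadBody s) (st f) _ _ :=
      Runs.case_wk (o := Option.some (Option.some a)) (by simp [hs, BTree.word]) h₁
    refine (Runs.loopStep (by simp [st, hcnt]) h₂ (h.start ?_)).mono (by simp; omega)
    congr 1
    simp [hs, hcnt, BTree.word, Function.update_of_ne ha.symm, Function.update_of_ne hc.symm]
  | node x y ihx ihy =>
    intro f m c S n hs hcnt h
    have h₁ := (Runs.pop_wk f s).seq ((Runs.push_wk _ .aux Option.none).seq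
      (Runs.push_wk _ .cnt Option.none))
    have h₂ : Runs (unloadBody s) (st f) _ _ :=
      Runs.case_wk (o := Option.some Option.none) (by simp [hs, BTree.word]) h₁
    refine (Runs.loopStep (n' := 5 * x.size + (5 * y.size + n)) (by simp [st, hcnt]) h₂
      (ihx (m := y.word ++ m) (c := Option.none :: c) ?_ ?_ (ihy (m := m) (c := c) ?_ ?_
        (h.start ?_)))).mono (by simp; omega)
    · simp [hs, BTree.word, Function.update_of_ne ha, Function.update_of_ne hc]
    · simp [hcnt, Function.update_of_ne hc.symm]
    · simp [Function.update_of_ne ha, Function.update_of_ne hc]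
    · simp
    · congr 1
      funext w
      cases s <;> cases w <;> simp_all [BTree.word]

theorem runs_unload {s : Wk} (ha : s ≠ .aux) (hc : s ≠ .cnt) (x : BTree)
    {f : Wk → List (Option Letter)} {m : List (Option Letter)}
    (hs : f s = x.word ++ m) (hcnt : f .cnt = []) :
    Runs (unload s) (st f) (st (Function.update (Function.update f s m)
      .aux (x.word.reverse ++ f .aux))) (5 * x.size + 2) := by
  refine ((Runs.push_wk f .cnt Option.none).seq (runs_unloadLoop (n := 1) ha hc x (m := m)
    (c := []) ?_ ?_ ((Runs.loopDone ?_).start ?_))).mono (by omega)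
  · simp [hs, Function.update_of_ne hc]
  · simp [hcnt]
  · simp [st, hcnt, Function.update_of_ne hc.symm]
  · congr 1
    funext w
    cases s <;> cases w <;> simp_all

/-- Empty the stack `aux`, doing `c a` for each symbol `a`. -/
def drain (c : Option Letter → Prog) : Prog :=
  .loop (.wk .aux) Option.isSome (.case (.wk .aux) fun o => match o with
    | Option.none => .skip
    | Option.some a => .seq (.pop (.wk .aux)) (c a))

/-- `F p l` is the store when the symbols `p` (latest first) have been treated and `l` is still on
`aux`. Each round costs the loop test, the case, the pop and the `k` steps of `c`. Since `aux` holds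
a word in reverse, draining restores its order. -/
theorem runs_drain {c : Option Letter → Prog} {k : ℕ}
    (F : List (Option Letter) → List (Option Letter) → Wk → List (Option Letter))
    (hF : ∀ p l, F p l .aux = l)
    (hc : ∀ p a l, Runs (c a) (st (Function.update (F p (a :: l)) .aux l)) (st (F (a :: p) l)) k)
    (l : List (Option Letter)) :
    ∀ p, Runs (drain c) (st (F p l)) (st (F (l.reverse ++ p) [])) ((k + 3) * l.length + 1) := by
  induction l with
  | nil => exact fun p => Runs.loopDone (by simp [st, hF])
  | cons a l ih =>
    intro p
    have h₁ := (Runs.pop_wk (F p (a :: l)) .aux).seq ((hc p a l).start (by simp [hF]))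
    refine ((Runs.loopStep (by simp [st, hF]) (Runs.case_wk (o := Option.some a) (by simp [hF]) h₁)
      (ih (a :: p))).mono ?_).congr (by simp)
    simp only [List.length_cons, Nat.mul_add]
    omega

/-- Move one tree from the stack `s` to the stack `d`. -/
def move (s d : Wk) : Prog := .seq (unload s) (drain fun a => .push (.wk d) a)

theorem runs_move {s d : Wk} (ha : s ≠ .aux) (hc : s ≠ .cnt) (hd : d ≠ .aux) (hsd : s ≠ d)
    (x : BTree) {f : Wk → List (Option Letter)} {m : List (Option Letter)}
    (hs : f s = x.word ++ m) (hcnt : f .cnt = []) (haux : f .aux = []) :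
    Runs (move s d) (st f) (st (Function.update (Function.update f s m) d (x.word ++ f d)))
      (9 * x.size + 3) := by
  have h₂ := runs_drain (c := fun a => .push (.wk d) a) (k := 1)
    (fun p l => Function.update (Function.update (Function.update f s m) d (p ++ f d)) .aux l)
    (fun p l => by simp) (fun p a l => (Runs.push_wk _ d a).congr (by
      congr 1
      funext w
      cases d <;> cases w <;> simp_all)) x.word.reverse []
  refine (((runs_unload ha hc x hs hcnt).seq (h₂.start ?_)).mono ?_).congr ?_
  · congr 1
    funext w
    cases d <;> cases s <;> cases w <;> simp_all
  · simp [BTree.size]; omega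
  · congr 1
    funext w
    cases d <;> cases s <;> cases w <;> simp_all

/-- The store between the operations below: only `main` and `ret` are nonempty. -/
def store (m r : List (Option Letter)) : Store := st (wk m r [] [] [])

section
variable (x y : BTree) (m r : List (Option Letter))

/-- Move a tree to the stack `ret`. -/
def toRet : Prog := move .main .ret

theorem runs_toRet : Runs toRet (store (x.word ++ m) r) (store m (x.word ++ r))
    (9 * x.size + 3) :=
  (runs_move (by simp) (by simp) (by simp) (by simp) x (m := m) (by simp) (by simp)
    (by simp)).congr (by simp [store])

/-- Move a tree back from the stack `ret`. -/
def fromRet : Prog := move .ret .main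

theorem runs_fromRet : Runs fromRet (store m (x.word ++ r)) (store (x.word ++ m) r)
    (9 * x.size + 3) :=
  (runs_move (by simp) (by simp) (by simp) (by simp) x (m := r) (by simp) (by simp)
    (by simp)).congr (by simp [store])

/-- Remove a tree. -/
def drop : Prog := .seq (unload .main) (drain fun _ => .skip)

theorem runs_drop : Runs drop (store (x.word ++ m) r) (store m r) (9 * x.size + 3) := by
  refine (((runs_unload (by simp) (by simp) x (m := m) (by simp) (by simp)).seq
    ((runs_drain (k := 1) (fun _ l => wk m r [] l []) (by simp)
      (fun p a l => Runs.skip.congr (by simp)) x.word.reverse []).start ?_)).mono ?_).congr ?_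
  · simp
  · simp [BTree.size]; omega
  · rfl

/-- Duplicate a tree. -/
def dup : Prog :=
  .seq (unload .main) (.seq (drain fun a => .seq (.push (.wk .main) a) (.push (.wk .ret) a))
    fromRet)

theorem runs_dup : Runs dup (store (x.word ++ m) r) (store (x.word ++ (x.word ++ m)) r)
    (19 * x.size + 6) := by
  have h₂ := runs_drain (k := 2)
    (c := fun a => .seq (.push (.wk .main) a) (.push (.wk .ret) a))
    (fun p l => wk (p ++ m) (p ++ r) [] l []) (by simp)
    (fun p a l => ((Runs.push_wk _ _ a).seq (Runs.push_wk _ _ a)).congr (by simp))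
    x.word.reverse []
  refine ((runs_unload (by simp) (by simp) x (m := m) (by simp) (by simp)).seq
    ((h₂.start ?_).seq ((runs_fromRet x (x.word ++ m) r).start ?_))).mono ?_
  · simp
  · simp [store]
  · simp [BTree.size]; omega

/-- Exchange two trees. -/
def swap : Prog :=
  .seq (move .main .ret) (.seq (move .main .buf) (.seq (move .ret .main) (move .buf .main)))

theorem runs_swap : Runs swap (store (x.word ++ (y.word ++ m)) r)
    (store (y.word ++ (x.word ++ m)) r) (18 * x.size + 18 * y.size + 12) := by
  refine (((runs_move (by simp) (by simp) (by simp) (by simp) x (m := y.word ++ m)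
      (by simp) (by simp) (by simp)).seq
    ((runs_move (by simp) (by simp) (by simp) (by simp) y (m := m)
      (by simp) (by simp) (by simp)).seq
    ((runs_move (by simp) (by simp) (by simp) (by simp) x (m := r)
      (by simp) (by simp) (by simp)).seq
    (runs_move (by simp) (by simp) (by simp) (by simp) y (m := [])
      (by simp) (by simp) (by simp))))).mono ?_).congr ?_
  · omega
  · simp [store]

/-- Put a symbol on the main stack. -/
def pushMain (a : Option Letter) : Prog := .push (.wk .main) a

theorem runs_pushMain (a : Option Letter) : Runs (pushMain a) (store m r) (store (a :: m) r) 1 :=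
  (Runs.push_wk _ _ a).congr (by simp [store])

/-- Remove a symbol from the main stack. -/
def popMain : Prog := .pop (.wk .main)

theorem runs_popMain (a : Option Letter) : Runs popMain (store (a :: m) r) (store m r) 1 :=
  (Runs.pop_wk _ _).congr (by simp [store])

theorem runs_caseMain {a : Option Letter} {g : Option (Option Letter) → Prog} {S : Store} {n : ℕ}
    (h : Runs (g (Option.some a)) (store (a :: m) r) S n) :
    Runs (.case (.wk .main) g) (store (a :: m) r) S (1 + n) :=
  Runs.case_wk rfl h

end

/-! ### Comparison of trees -/

/-- Replace the symbol on the main stack by `false`. -/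
def refute : Prog := .seq popMain (pushMain (Option.some (.bit false)))

theorem runs_refute (v : Bool) (m r b a c : List (Option Letter)) :
    Runs refute (st (wk (Option.some (.bit v) :: m) r b a c))
      (st (wk (Option.some (.bit false) :: m) r b a c)) 2 :=
  ((Runs.pop_wk _ _).seq (Runs.push_wk _ _ _)).congr (by simp)

/-- Compare the contents of `cnt` and `buf` as long as they agree. -/
noncomputable def compareCnt : Prog :=
  .loop (.wk .cnt) Option.isSome (.case (.wk .cnt) fun o => .seq (.pop (.wk .cnt))
    (.case (.wk .buf) fun o' => if o' = o then .pop (.wk .buf) else refute))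

/-- The invariant is the conjunction of the verdict with equality of the two remaining words. After
a mismatch the verdict stays `false` while the loop goes on to empty `cnt`; what remains in `buf` is
left to `clearBuf`. -/
theorem runs_compareCnt (m r c : List (Option Letter)) : ∀ (v : Bool) (b : List (Option Letter)),
    ∃ v' b', b'.length ≤ b.length ∧ (v' && decide (b' = [])) = (v && decide (c = b)) ∧
      Runs compareCnt (st (wk (Option.some (.bit v) :: m) r b [] c))
        (st (wk (Option.some (.bit v') :: m) r b' [] [])) (6 * c.length + 1) := by
  induction c with
  | nil => exact fun v b => ⟨v, b, le_rfl, by simp [eq_comm], Runs.loopDone (by simp [st])⟩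
  | cons a c ih =>
    intro v b
    by_cases hb : b.head? = Option.some a
    · obtain ⟨b, rfl⟩ : ∃ b', b = a :: b' := by
        cases b with
        | nil => simp at hb
        | cons a' b => simp at hb; exact ⟨b, by rw [hb]⟩
      obtain ⟨v', b', hl, hv, h⟩ := ih v b
      refine ⟨v', b', by simp; omega, by simp [hv], ?_⟩
      refine (Runs.loopStep (by simp [st]) (Runs.case_wk (o := Option.some a) (by simp)
        ((Runs.pop_wk _ _).seq (Runs.case_wk (o := Option.some a) (n := 1) (by simp) ?_)))
        h).mono (by simp; omega)
      rw [if_pos rfl]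
      exact (Runs.pop_wk _ _).congr (by simp)
    · obtain ⟨v', b', hl, hv, h⟩ := ih false b
      refine ⟨v', b', hl, ?_, ?_⟩
      · rw [hv]
        cases v <;> simp
        rintro rfl
        simp at hb
      refine (Runs.loopStep (by simp [st]) (Runs.case_wk (o := Option.some a) (by simp)
        ((Runs.pop_wk _ _).seq (Runs.case_wk (o := b.head?) (n := 2) (by simp) ?_)))
        h).mono (by simp; omega)
      rw [if_neg hb]
      exact (runs_refute v m r b [] c).start (by simp)

/-- Empty `buf`; if there is something in it, the answer is `false`. -/
def clearBuf : Prog := .loop (.wk .buf) Option.isSome (.seq (.pop (.wk .buf)) refute)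

theorem runs_clearBuf (m r b : List (Option Letter)) : ∀ (v : Bool),
    Runs clearBuf (st (wk (Option.some (.bit v) :: m) r b [] []))
      (st (wk (Option.some (.bit (v && decide (b = []))) :: m) r [] [] []))
      (4 * b.length + 1) := by
  induction b with
  | nil => exact fun v => (Runs.loopDone (by simp [st])).congr (by simp)
  | cons a b ih =>
    intro v
    refine ((Runs.loopStep (by simp [st]) ((Runs.pop_wk _ _).seq
      ((runs_refute v m r b [] []).start (by simp))) (ih false)).mono (by simp; omega)).congr
        (by simp)

/-- Compare two trees. -/
noncomputable def compareTrees : Prog :=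
  .seq (move .main .buf) (.seq (move .main .cnt)
    (.seq (pushMain (Option.some (.bit true))) (.seq compareCnt clearBuf)))

open Classical in
theorem runs_compareTrees (x y : BTree) (m r : List (Option Letter)) :
    Runs compareTrees (store (x.word ++ (y.word ++ m)) r)
      (store (Option.some (.bit (decide (x = y))) :: m) r) (20 * (x.size + y.size) + 20) := by
  obtain ⟨v', b', hl, hv, h⟩ := runs_compareCnt m r y.word true x.word
  refine (((runs_move (by simp) (by simp) (by simp) (by simp) x (m := y.word ++ m)
      (by simp) (by simp) (by simp)).seq
    ((runs_move (by simp) (by simp) (by simp) (by simp) y (m := m)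
      (by simp) (by simp) (by simp)).seq ((Runs.push_wk _ .main (Option.some (.bit true))).seq
      ((h.start (by simp)).seq (runs_clearBuf m r b' v'))))).mono ?_).congr ?_
  · simp only [BTree.size] at *; omega
  · rw [hv]
    simp [store, BTree.word_inj, eq_comm]

end Syllogistic

namespace Syllogistic

/-! ### Polynomial-time functions on coded data -/

/-- A coding of data by trees. -/
class Code (α : Type) where
  code : α → BTree

open Code

/-- Codings which are injective. -/
class InjCode (α : Type) [Code α] : Prop where
  inj : Function.Injective (code : α → BTree)

instance : Code Letter := ⟨.leaf⟩

instance : Code Bool := ⟨fun b => .leaf (.bit b)⟩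

instance {α β : Type} [Code α] [Code β] : Code (α × β) := ⟨fun x => .node (code x.1) (code x.2)⟩

instance {α : Type} [Code α] : Code (List α) :=
  ⟨fun l => l.foldr (fun a t => .node (code a) t) (.leaf .endMark)⟩

section
variable {α β γ δ : Type} [Code α] [Code β] [Code γ] [Code δ]

theorem code_letter (a : Letter) : code a = .leaf a := rfl
theorem code_bool (b : Bool) : code b = .leaf (.bit b) := rfl
theorem code_prod (x : α × β) : code x = .node (code x.1) (code x.2) := rfl
theorem code_mk (x : α) (y : β) : code (x, y) = .node (code x) (code y) := rfl
theorem code_nil : code ([] : List α) = .leaf .endMark := rfl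
theorem code_cons (a : α) (l : List α) : code (a :: l) = .node (code a) (code l) := rfl

instance : InjCode Letter := ⟨fun _ _ h => BTree.leaf.inj h⟩

instance [InjCode α] [InjCode β] : InjCode (α × β) :=
  ⟨fun x y h => by
    obtain ⟨h₁, h₂⟩ := BTree.node.inj h
    exact Prod.ext (InjCode.inj h₁) (InjCode.inj h₂)⟩

theorem code_list_inj (h : Function.Injective (code : α → BTree)) :
    Function.Injective (code : List α → BTree) := by
  intro l
  induction l with
  | nil => intro l' h'; cases l' <;> simp_all [code_nil, code_cons]
  | cons a l ih =>
    intro l' h'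
    cases l' with
    | nil => simp [code_nil, code_cons] at h'
    | cons a' l' =>
      obtain ⟨h₁, h₂⟩ := BTree.node.inj h'
      rw [h h₁, ih h₂]

instance [InjCode α] : InjCode (List α) := ⟨code_list_inj InjCode.inj⟩

/-- The size of the code. -/
def sz (a : α) : ℕ := (code a).size

@[simp] theorem sz_letter (a : Letter) : sz a = 1 := rfl
@[simp] theorem sz_bool (b : Bool) : sz b = 1 := rfl
@[simp] theorem sz_mk (x : α) (y : β) : sz (x, y) = sz x + sz y + 1 := by
  simp [sz, code_mk]
@[simp] theorem sz_nil : sz ([] : List α) = 1 := rfl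
@[simp] theorem sz_cons (a : α) (l : List α) : sz (a :: l) = sz a + sz l + 1 := by
  simp [sz, code_cons]
theorem one_le_sz (a : α) : 1 ≤ sz a := BTree.one_le_size _

theorem length_lt_sz (l : List α) : l.length < sz l := by
  induction l with
  | nil => simp
  | cons a l ih => simp; omega

theorem sz_append (l l' : List α) : sz (l ++ l') + 1 = sz l + sz l' := by
  induction l with
  | nil => simp [Nat.add_comm]
  | cons a l ih => simp; omega

theorem sz_le_of_mem {a : α} {l : List α} (h : a ∈ l) : sz a < sz l := by
  induction l with
  | nil => simp at h
  | cons b l ih =>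
    rcases List.mem_cons.mp h with rfl | h
    · simp only [sz_cons]; omega
    · have := ih h; simp; omega

end

theorem eval_mono (p : Polynomial ℕ) : Monotone fun n => p.eval n := by
  intro n m h
  induction p using Polynomial.induction_on' with
  | add p q hp hq => simpa using Nat.add_le_add hp hq
  | monomial k a => simpa using Nat.mul_le_mul_left a (Nat.pow_le_pow_left h k)

/-- Functions computed on the work stacks in polynomial time. -/
@[fun_prop]
def FP {α β : Type} [Code α] [Code β] (f : α → β) : Prop :=
  ∃ (c : Prog) (p : Polynomial ℕ), ∀ a m r, Runs c (store ((code a).word ++ m) r)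
    (store ((code (f a)).word ++ m) r) (p.eval (sz a))

namespace FP

variable {α β γ δ : Type} [Code α] [Code β] [Code γ] [Code δ]

/-- A program adds at most one symbol per step to the main stack, so its running time bounds the
growth of the data. This is what allows time bounds to be composed. -/
theorem sz_le {f : α → β} (hf : FP f) : ∃ p : Polynomial ℕ, ∀ a, sz (f a) ≤ p.eval (sz a) := by
  obtain ⟨c, p, h⟩ := hf
  refine ⟨p + Polynomial.X, fun a => ?_⟩
  obtain ⟨t, ht, hr⟩ := h a [] []
  have := hr.length_main_le
  simp only [store, st, wk_main, List.append_nil] at this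
  simp only [Polynomial.eval_add, Polynomial.eval_X]
  simp only [sz, BTree.size] at *
  omega

theorem of_code {f : α → β} (h : ∀ a, code (f a) = code a) : FP f :=
  ⟨.skip, 1, fun a m r => (Runs.skip.mono (by simp)).congr (by rw [h])⟩

@[fun_prop]
theorem id : FP (fun x : α => x) := of_code fun _ => rfl

@[fun_prop]
theorem comp {f : α → β} {g : β → γ} (hg : FP g) (hf : FP f) : FP (fun x => g (f x)) := by
  obtain ⟨q, hq⟩ := hf.sz_le
  obtain ⟨c, p, h⟩ := hf
  obtain ⟨c', p', h'⟩ := hg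
  refine ⟨.seq c c', p + p'.comp q, fun a m r => ((h a m r).seq (h' (f a) m r)).mono ?_⟩
  simp only [Polynomial.eval_add, Polynomial.eval_comp]
  exact Nat.add_le_add_left (eval_mono p' (hq a)) _

end FP

/-! ### Basic polynomial-time functions: pairing, case distinction, comparison, access to lists. -/

open Classical in
/-- The truth value of an equation. -/
noncomputable def same {α : Type} (a b : α) : Bool := decide (a = b)

@[simp] theorem same_eq_true {α : Type} {a b : α} : same a b = true ↔ a = b := by simp [same]

/-- Put a word on the main stack. -/
def pushWord : List (Option Letter) → Prog
  | [] => .skip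
  | a :: w => .seq (pushWord w) (pushMain a)

theorem runs_pushWord (w m r : List (Option Letter)) :
    Runs (pushWord w) (store m r) (store (w ++ m) r) (w.length + 1) := by
  induction w with
  | nil => exact Runs.skip.mono (by simp)
  | cons a w ih => exact (ih.seq (runs_pushMain _ r a)).mono (by simp)

theorem word_node_append (x y : BTree) (m : List (Option Letter)) :
    (BTree.node x y).word ++ m = Option.none :: (x.word ++ (y.word ++ m)) := by
  simp [BTree.word]

namespace FP

variable {α β γ δ : Type} [Code α] [Code β] [Code γ] [Code δ]

@[fun_prop]
theorem const (b : β) : FP (fun _ : α => b) :=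
  ⟨.seq drop (pushWord (code b).word), 9 * Polynomial.X + Polynomial.C (sz b + 4), fun a m r =>
    ((runs_drop (code a) m r).seq (runs_pushWord (code b).word m r)).mono (by
      simp [sz, BTree.size]; omega)⟩

-- The second component is computed first, above a copy of the argument. After an exchange the first
-- component is computed on top of it, and the symbol for an inner node joins the two codes.
@[fun_prop]
theorem prodMk {f : α → β} {g : α → γ} (hf : FP f) (hg : FP g) : FP (fun x => (f x, g x)) := by
  obtain ⟨q, hq⟩ := hg.sz_le
  obtain ⟨c, p, h⟩ := hf
  obtain ⟨c', p', h'⟩ := hg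
  refine ⟨.seq dup (.seq c' (.seq swap (.seq c (pushMain Option.none)))),
    19 * Polynomial.X + 6 + (p' + (18 * q + 18 * Polynomial.X + 12 + (p + 1))), fun a m r =>
    (((runs_dup _ m r).seq ((h' a _ r).seq ((runs_swap _ _ m r).seq ((h a _ r).seq
      (runs_pushMain _ r _))))).mono ?_).congr ?_⟩
  · have := hq a
    simp [sz] at *
    omega
  · rw [code_mk, word_node_append]

@[fun_prop]
theorem fst : FP (Prod.fst : α × β → α) :=
  ⟨.seq popMain (.seq swap drop), 30 * Polynomial.X + 30, fun ⟨a, b⟩ m r =>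
    (((runs_popMain _ r _).seq ((runs_swap (code a) (code b) m r).seq
      (runs_drop (code b) _ r))).start (by rw [code_mk, word_node_append])).mono (by
        simp [sz, code_mk]; omega)⟩

@[fun_prop]
theorem snd : FP (Prod.snd : α × β → β) :=
  ⟨.seq popMain drop, 30 * Polynomial.X + 30, fun ⟨a, b⟩ m r =>
    (((runs_popMain _ r _).seq (runs_drop (code a) _ r)).start
      (by rw [code_mk, word_node_append])).mono (by simp [sz, code_mk]; omega)⟩

@[fun_prop]
theorem fst' {f : α → β × γ} (hf : FP f) : FP (fun x => (f x).1) := fst.comp hf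

@[fun_prop]
theorem snd' {f : α → β × γ} (hf : FP f) : FP (fun x => (f x).2) := snd.comp hf

@[fun_prop]
theorem cons {f : α → β} {g : α → List β} (hf : FP f) (hg : FP g) :
    FP (fun x => f x :: g x) := by
  obtain ⟨c, p, h⟩ := hf.prodMk hg
  exact ⟨c, p, h⟩

/-- The program branches on one of finitely many letters, so the sum of the bounds for all branches
bounds each of them. -/
theorem letterCases {l : α → Letter} {F : Letter → α → β} (hl : FP l) (hF : ∀ a, FP (F a)) :
    FP (fun x => F (l x) x) := by
  obtain ⟨c, p, h⟩ := hl
  choose C P H using hF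
  refine ⟨.seq dup (.seq c (.case (.wk .main) fun o => match o with
    | Option.some (Option.some a) => .seq popMain (C a)
    | _ => .skip)), 19 * Polynomial.X + 6 + (p + (2 + ∑ a, P a)), fun a m r => ?_⟩
  refine ((runs_dup _ m r).seq ((h a _ r).seq (runs_caseMain ((code a).word ++ m) r
    (a := Option.some (l a)) ((runs_popMain _ r _).seq (H (l a) a m r))))).mono ?_
  simp only [Polynomial.eval_add, Polynomial.eval_finsetSum, Polynomial.eval_mul,
    Polynomial.eval_X, Polynomial.eval_ofNat]
  have := Finset.single_le_sum (f := fun b => (P b).eval (sz a)) (fun _ _ => Nat.zero_le _)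
    (Finset.mem_univ (l a))
  simp only [sz] at *
  omega

@[fun_prop]
theorem cond {b : α → Bool} {f g : α → β} (hb : FP b) (hf : FP f) (hg : FP g) :
    FP (fun x => bif b x then f x else g x) := by
  -- A truth value has the same code as the corresponding letter, so the same program computes it.
  have h : FP (fun x => Letter.bit (b x)) := by
    obtain ⟨c, p, h⟩ := hb
    exact ⟨c, p, h⟩
  have := letterCases (F := fun a x => match a with
    | .bit true => f x
    | _ => g x) h (fun a => by
      rcases a with (_ | _) | _ | _ | _ | _ | _ | _ | _ <;> first | exact hf | exact hg)
  convert this using 2 with x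
  cases b x <;> rfl

@[fun_prop]
theorem and {b c : α → Bool} (hb : FP b) (hc : FP c) : FP (fun x => b x && c x) := by
  convert hb.cond hc (const false) using 2 with x
  cases b x <;> rfl

@[fun_prop]
theorem or {b c : α → Bool} (hb : FP b) (hc : FP c) : FP (fun x => b x || c x) := by
  convert hb.cond (const true) hc using 2 with x
  cases b x <;> rfl

@[fun_prop]
theorem not {b : α → Bool} (hb : FP b) : FP (fun x => !b x) := by
  convert hb.cond (const false) (const true) using 2 with x
  cases b x <;> rfl

@[fun_prop]
theorem same [InjCode β] {f g : α → β} (hf : FP f) (hg : FP g) :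
    FP (fun x => same (f x) (g x)) := by
  have h : FP (fun x : β × β => Syllogistic.same x.1 x.2) := by
    refine ⟨.seq popMain compareTrees, 20 * Polynomial.X + 30, fun ⟨a, b⟩ m r => ?_⟩
    refine ((((runs_popMain _ r _).seq (runs_compareTrees (code a) (code b) m r)).start
      (by rw [code_mk, word_node_append])).mono ?_).congr ?_
    · simp [sz, code_mk]; omega
    · by_cases hab : a = b
      · simp [code_bool, BTree.word, Syllogistic.same, hab]
      · have hc : code a ≠ code b := fun h => hab (InjCode.inj h)
        simp [code_bool, BTree.word, Syllogistic.same, hab, hc]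
  exact h.comp (hf.prodMk hg)

@[fun_prop]
theorem tail {f : α → List β} (hf : FP f) : FP (fun x => (f x).tail) := by
  have h : FP (List.tail : List β → List β) := by
    refine ⟨.case (.wk .main) fun o => match o with
      | Option.some Option.none => .seq popMain drop
      | _ => .skip, 20 * Polynomial.X + 30, fun l m r => ?_⟩
    cases l with
    | nil => exact (runs_caseMain m r (a := Option.some _) Runs.skip).mono (by simp)
    | cons a l =>
      refine ((runs_caseMain _ r (a := Option.none) ((runs_popMain _ r _).seq
        (runs_drop (code a) ((code l).word ++ m) r))).start ?_).mono ?_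
      · rw [code_cons, word_node_append]
      · simp [sz, code_cons]; omega
  exact h.comp hf

-- On the empty list the program leaves the stack alone: the code of `[]` is the same leaf at every
-- type, so the default value is already in place.
@[fun_prop]
theorem headD {f : α → List (List β)} (hf : FP f) : FP (fun x => (f x).headD []) := by
  have h : FP (fun l : List (List β) => l.headD []) := by
    refine ⟨.case (.wk .main) fun o => match o with
      | Option.some Option.none => .seq popMain (.seq swap drop)
      | _ => .skip, 40 * Polynomial.X + 30, fun l m r => ?_⟩
    cases l with
    | nil => exact (runs_caseMain m r (a := Option.some _) Runs.skip).mono (by simp)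
    | cons a l =>
      refine ((runs_caseMain _ r (a := Option.none) ((runs_popMain _ r _).seq
        ((runs_swap (code a) (code l) m r).seq (runs_drop (code l) _ r)))).start ?_).mono ?_
      · rw [code_cons, word_node_append]
      · simp [sz, code_cons]; omega
  exact h.comp hf

end FP

end Syllogistic

namespace Syllogistic

open Code

/-! ### Folds -/

/-- The loop of a fold: the main stack holds a list, the accumulator, and the context; the program
`c` computes the next accumulator. -/
def foldBody (c : Prog) : Prog :=
  .seq popMain (.seq swap (.seq toRet (.seq swap (.seq (pushMain Option.none) (.seq toRet
    (.seq dup (.seq fromRet (.seq swap (.seq (pushMain Option.none) (.seq c fromRet))))))))))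

/-- Does the main stack start with an inner node? -/
def isNode : Option (Option Letter) → Bool
  | Option.some Option.none => true
  | _ => false

section
variable {α β γ : Type} [Code α] [Code β] [Code γ]

/-- The context survives the round because it is duplicated while the pair of accumulator and entry
waits on `ret`, above the rest of the list. -/
theorem runs_foldBody {f : α → β → γ → β} {c : Prog} {p : Polynomial ℕ}
    (h : ∀ (a : α × β × γ) m r, Runs c (store ((code a).word ++ m) r)
      (store ((code (f a.1 a.2.1 a.2.2)).word ++ m) r) (p.eval (sz a)))
    (x : α) (b : β) (a : γ) (l : List γ) (m r : List (Option Letter)) {N : ℕ}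
    (hN : sz x + sz b + sz (a :: l) ≤ N) :
    Runs (foldBody c)
      (store ((code (a :: l)).word ++ ((code b).word ++ ((code x).word ++ m))) r)
      (store ((code l).word ++ ((code (f x b a)).word ++ ((code x).word ++ m))) r)
      (200 * N + 200 + p.eval (N + 2)) := by
  refine (((runs_popMain _ r Option.none).seq ((runs_swap (code a) (code l)
    ((code b).word ++ ((code x).word ++ m)) r).seq
    ((runs_toRet (code l) _ r).seq ((runs_swap (code a) (code b) ((code x).word ++ m)
      ((code l).word ++ r)).seq
    ((runs_pushMain _ _ _).seq (((runs_toRet (code (b, a)) ((code x).word ++ m)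
      ((code l).word ++ r)).start ?_).seq
    ((runs_dup (code x) m _).seq ((runs_fromRet (code (b, a)) _ _).seq
    ((runs_swap (code (b, a)) (code x) ((code x).word ++ m) ((code l).word ++ r)).seq
    ((runs_pushMain _ _ Option.none).seq
    (((h (x, b, a) ((code x).word ++ m) ((code l).word ++ r)).start ?_).seq
    (runs_fromRet (code l) _ r)))))))))))).start ?_).mono ?_
  · rw [code_mk, word_node_append]
  · rw [code_mk x, word_node_append, code_mk b, word_node_append]
  · rw [code_cons, word_node_append]
  -- The summand 2 accounts for the two inner nodes of the code of the triple.
  · have h₁ : p.eval (sz (x, b, a)) ≤ p.eval (N + 2) := eval_mono p (by simp at *; omega)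
    simp [sz, code_mk, code_cons] at *
    omega

/-- The bound on the accumulator is assumed for all prefixes of the list, so that one `N` bounds the
cost of every round. -/
theorem runs_foldLoop {f : α → β → γ → β} {c : Prog} {p : Polynomial ℕ}
    (h : ∀ (a : α × β × γ) m r, Runs c (store ((code a).word ++ m) r)
      (store ((code (f a.1 a.2.1 a.2.2)).word ++ m) r) (p.eval (sz a)))
    (x : α) (m r : List (Option Letter)) {N : ℕ} (l : List γ) : ∀ (b : β),
    (∀ l', l' <+: l → sz x + sz (l'.foldl (f x) b) + sz l ≤ N) →
    Runs (.loop (.wk .main) isNode (foldBody c))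
      (store ((code l).word ++ ((code b).word ++ ((code x).word ++ m))) r)
      (store ((code ([] : List γ)).word ++ ((code (l.foldl (f x) b)).word ++
        ((code x).word ++ m))) r)
      (l.length * (200 * N + 201 + p.eval (N + 2)) + 1) := by
  induction l with
  | nil =>
    intro b _
    exact (Runs.loopDone (by simp [store, st, code_nil, BTree.word, isNode])).mono (by simp)
  | cons a l ih =>
    intro b hN
    refine (Runs.loopStep ?_ (runs_foldBody h x b a l m r (N := N) ?_)
      (ih (f x b a) ?_)).mono ?_
    · simp [store, st, code_cons, BTree.word, isNode]
    · exact hN [] List.nil_prefix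
    · intro l' hl'
      have := hN (a :: l') ((List.prefix_cons_inj a).mpr hl')
      simp at this
      omega
    · simp only [List.length_cons, Nat.add_mul]
      omega

/-- Polynomial-time steps alone do not suffice, since an accumulator that doubles in each round
becomes exponentially long. With a polynomial bound `hq` on all intermediate values, each round has
polynomial cost, and the number of rounds is bounded by the size of the list. -/
theorem FP.foldl {l : α → List γ} {b : α → β} {f : α → β → γ → β} (hl : FP l) (hb : FP b)
    (hf : FP (fun a : α × β × γ => f a.1 a.2.1 a.2.2))
    (hq : ∃ q : Polynomial ℕ, ∀ x l', l' <+: l x →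
      sz (l'.foldl (f x) (b x)) ≤ q.eval (sz x)) :
    FP (fun x => (l x).foldl (f x) (b x)) := by
  obtain ⟨q, hq⟩ := hq
  obtain ⟨ql, hql⟩ := hl.sz_le
  obtain ⟨cl, pl, hl⟩ := hl
  obtain ⟨cb, pb, hb⟩ := hb
  obtain ⟨c, p, h⟩ := hf
  let N : Polynomial ℕ := Polynomial.X + q + ql
  refine ⟨.seq dup (.seq cb (.seq toRet (.seq dup (.seq fromRet (.seq swap (.seq cl
    (.seq (.loop (.wk .main) isNode (foldBody c)) (.seq popMain (.seq swap drop))))))))),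
    200 * N + 200 + pb + pl + ql * (200 * N + 201 + p.comp (N + 2)), fun x m r => ?_⟩
  have hN : ∀ l', l' <+: l x → sz x + sz (l'.foldl (f x) (b x)) + sz (l x) ≤ N.eval (sz x) := by
    intro l' hl'
    have h₁ := hq x l' hl'
    have h₂ := hql x
    simp only [N, Polynomial.eval_add, Polynomial.eval_X]
    omega
  have h₀ := hN [] List.nil_prefix
  have h₁ := hN _ (List.prefix_rfl)
  have h₂ := hql x
  have h₃ : (l x).length * (200 * N.eval (sz x) + 201 + p.eval (N.eval (sz x) + 2)) ≤
      ql.eval (sz x) * (200 * N.eval (sz x) + 201 + p.eval (N.eval (sz x) + 2)) :=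
    Nat.mul_le_mul_right _ ((length_lt_sz _).le.trans h₂)
  refine (((runs_dup (code x) m r).seq ((hb x _ r).seq ((runs_toRet (code (b x)) _ r).seq
    ((runs_dup (code x) m _).seq ((runs_fromRet (code (b x)) _ r).seq
    ((runs_swap (code (b x)) (code x) _ r).seq ((hl x _ r).seq
    ((runs_foldLoop h x m r (l x) (b x) hN).seq ((runs_popMain _ r _).seq
    ((runs_swap (code ((l x).foldl (f x) (b x))) (code x) m r).seq
    (runs_drop (code x) _ r))))))))))).mono ?_)
  simp only [List.foldl_nil] at h₀
  simp only [Polynomial.eval_add, Polynomial.eval_mul, Polynomial.eval_comp,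
    Polynomial.eval_ofNat]
  simp only [sz] at *
  omega

/-- Folds where each step lengthens the accumulator by a number that depends on the context
only. -/
theorem FP.foldl_of_step {l : α → List γ} {b : α → β} {f : α → β → γ → β} (hl : FP l) (hb : FP b)
    (hf : FP (fun a : α × β × γ => f a.1 a.2.1 a.2.2))
    (hq : ∃ q : Polynomial ℕ, ∀ x b, ∀ a ∈ l x, sz (f x b a) ≤ sz b + q.eval (sz x)) :
    FP (fun x => (l x).foldl (f x) (b x)) := by
  obtain ⟨q, hq⟩ := hq
  obtain ⟨ql, hql⟩ := hl.sz_le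
  obtain ⟨qb, hqb⟩ := hb.sz_le
  refine FP.foldl hl hb hf ⟨qb + ql * q, fun x l' hl' => ?_⟩
  have h : ∀ (l' : List γ) (b' : β), (∀ a ∈ l', a ∈ l x) →
      sz (l'.foldl (f x) b') ≤ sz b' + l'.length * q.eval (sz x) := by
    intro l'
    induction l' with
    | nil => simp
    | cons a l' ih =>
      intro b' ha
      have h₁ := ih (f x b' a) fun a' ha' => ha a' (List.mem_cons_of_mem _ ha')
      have h₂ := hq x b' a (ha a List.mem_cons_self)
      simp only [List.foldl_cons, List.length_cons, Nat.add_mul]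
      omega
  have h₁ := h l' (b x) fun a ha => hl'.subset ha
  have h₂ := hqb x
  have h₃ := hql x
  have h₄ : l'.length * q.eval (sz x) ≤ ql.eval (sz x) * q.eval (sz x) :=
    Nat.mul_le_mul_right _ (hl'.length_le.trans ((length_lt_sz _).le.trans h₃))
  simp only [Polynomial.eval_add, Polynomial.eval_mul]
  omega

@[fun_prop]
theorem FP.reverse {l : α → List β} (hl : FP l) : FP (fun x => (l x).reverse) := by
  have h : FP (fun x => (l x).foldl (fun acc a => a :: acc) []) := by
    refine FP.foldl_of_step hl (by fun_prop) (by fun_prop) ?_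
    obtain ⟨q, hq⟩ := hl.sz_le
    refine ⟨q + 1, fun x b a ha => ?_⟩
    have := sz_le_of_mem ha
    have := hq x
    simp
    omega
  convert h using 2
  simp

@[fun_prop]
theorem FP.append {l l' : α → List β} (hl : FP l) (hl' : FP l') : FP (fun x => l x ++ l' x) := by
  have h : FP (fun x => (l x).reverse.foldl (fun acc a => a :: acc) (l' x)) := by
    refine FP.foldl_of_step hl.reverse (by fun_prop) (by fun_prop) ?_
    obtain ⟨q, hq⟩ := hl.sz_le
    refine ⟨q + 1, fun x b a ha => ?_⟩
    have := sz_le_of_mem (List.mem_reverse.mp ha)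
    have := hq x
    simp
    omega
  convert h using 2
  simp

@[fun_prop]
theorem FP.flatMap {l : α → List β} {f : α → β → List γ} (hl : FP l)
    (hf : FP (fun a : α × β => f a.1 a.2)) : FP (fun x => (l x).flatMap (f x)) := by
  -- Each step prepends its contribution, so the list is traversed from its end.
  have h : FP (fun x => (l x).reverse.foldl (fun acc a => f x a ++ acc) []) := by
    refine FP.foldl_of_step hl.reverse (by fun_prop) ?_ ?_
    · exact FP.append (hf.comp (by fun_prop : FP fun a : α × List γ × β => (a.1, a.2.2)))
        (by fun_prop)
    obtain ⟨q, hq⟩ := hl.sz_le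
    obtain ⟨q', hq'⟩ := hf.sz_le
    refine ⟨q'.comp (Polynomial.X + q + 1), fun x b a ha => ?_⟩
    have h₁ := sz_le_of_mem (List.mem_reverse.mp ha)
    have h₂ := hq x
    have h₃ := hq' (x, a)
    have h₄ := sz_append (f x a) b
    have h₅ : q'.eval (sz (x, a)) ≤ q'.eval (sz x + q.eval (sz x) + 1) :=
      eval_mono q' (by simp; omega)
    simp only [Polynomial.eval_comp, Polynomial.eval_add, Polynomial.eval_X, Polynomial.eval_one]
    dsimp only at h₃
    omega
  convert h using 2 with x
  rw [List.foldl_reverse]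
  induction l x with
  | nil => rfl
  | cons a l ih => simp [ih]

@[fun_prop]
theorem FP.map {l : α → List β} {f : α → β → γ} (hl : FP l)
    (hf : FP (fun a : α × β => f a.1 a.2)) : FP (fun x => (l x).map (f x)) := by
  have : FP (fun x => (l x).flatMap (fun b => [f x b])) := by fun_prop
  convert this using 2
  exact List.map_eq_flatMap

@[fun_prop]
theorem FP.filter {l : α → List β} {f : α → β → Bool} (hl : FP l)
    (hf : FP (fun a : α × β => f a.1 a.2)) : FP (fun x => (l x).filter (f x)) := by
  have : FP (fun x => (l x).flatMap (fun b => bif f x b then [b] else [])) := by fun_prop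
  convert this using 2 with x
  induction l x with
  | nil => rfl
  | cons a l ih => cases h : f x a <;> simp [ih, h]

@[fun_prop]
theorem FP.any {l : α → List β} {f : α → β → Bool} (hl : FP l)
    (hf : FP (fun a : α × β => f a.1 a.2)) : FP (fun x => (l x).any (f x)) := by
  have : FP (fun x => (l x).foldl (fun b a => b || f x a) false) := by
    refine FP.foldl_of_step hl (by fun_prop) ?_ ⟨0, fun x b a _ => by simp⟩
    exact FP.or (by fun_prop)
      (hf.comp (by fun_prop : FP fun a : α × Bool × β => (a.1, a.2.2)))
  convert this using 2 with x
  have h : ∀ (l : List β) b, (b || l.any (f x)) = l.foldl (fun b a => b || f x a) b := by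
    intro l
    induction l with
    | nil => simp
    | cons a l ih => intro b; rw [List.foldl_cons, ← ih]; simp [Bool.or_assoc]
  simpa using h (l x) false

@[fun_prop]
theorem FP.all {l : α → List β} {f : α → β → Bool} (hl : FP l)
    (hf : FP (fun a : α × β => f a.1 a.2)) : FP (fun x => (l x).all (f x)) := by
  have : FP (fun x => !(l x).any (fun b => !f x b)) := by fun_prop
  convert this using 2 with x
  simp [List.all_eq_not_any_not]

/-- The truth value of membership in a list. -/
noncomputable def isMem {α : Type} (a : α) (l : List α) : Bool := l.any (same a)

@[simp] theorem isMem_eq_true {α : Type} {a : α} {l : List α} : isMem a l = true ↔ a ∈ l := by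
  simp [isMem]

@[fun_prop]
theorem FP.isMem [InjCode β] {f : α → β} {l : α → List β} (hf : FP f) (hl : FP l) :
    FP (fun x => isMem (f x) (l x)) := by
  unfold Syllogistic.isMem
  fun_prop

end

end Syllogistic

namespace Syllogistic

open Code

/-! ### Input and output -/

/-- A store given by the input, the outputs and the main stack. -/
def io (i o : List Letter) (b : List Bool) (m : List (Option Letter)) : Store
  | .inp => i
  | .outW => o
  | .outB => b
  | .wk .main => m
  | .wk _ => []

section
variable (i o i' : List Letter) (b b' : List Bool) (m m' : List (Option Letter))

@[simp] theorem io_inp : io i o b m .inp = i := rfl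
@[simp] theorem io_outW : io i o b m .outW = o := rfl
@[simp] theorem io_outB : io i o b m .outB = b := rfl
@[simp] theorem io_main : io i o b m (.wk .main) = m := rfl

@[simp] theorem update_io_inp : Function.update (io i o b m) .inp i' = io i' o b m := by
  funext k; rcases k with _ | _ | _ | _ | _ <;> rfl
@[simp] theorem update_io_outW : Function.update (io i o b m) .outW i' = io i i' b m := by
  funext k; rcases k with _ | _ | _ | _ | _ <;> rfl
@[simp] theorem update_io_outB : Function.update (io i o b m) .outB b' = io i o b' m := by
  funext k; rcases k with _ | _ | _ | _ | _ <;> rfl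
@[simp] theorem update_io_main : Function.update (io i o b m) (.wk .main) m' = io i o b m' := by
  funext k; rcases k with _ | _ | _ | _ | _ <;> rfl

theorem single_inp : single .inp i = io i [] [] [] := by
  funext k; rcases k with _ | _ | _ | _ | _ <;> rfl
theorem single_outW : single .outW o = io [] o [] [] := by
  funext k; rcases k with _ | _ | _ | _ | _ <;> rfl
theorem single_outB : single .outB b = io [] [] b [] := by
  funext k; rcases k with _ | _ | _ | _ | _ <;> rfl
theorem store_nil : store m [] = io [] [] [] m := by
  funext k; rcases k with _ | _ | _ | _ | _ <;> rfl

end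

theorem Runs.push (k : Stk) (a : k.Sym) (S : Store) :
    Runs (.push k a) S (Function.update S k (a :: S k)) 1 := ⟨1, le_rfl, .push k a S⟩

theorem Runs.pop (k : Stk) (S : Store) :
    Runs (.pop k) S (Function.update S k (S k).tail) 1 := ⟨1, le_rfl, .pop k S⟩

theorem Runs.case' {k : Stk} {f : Option k.Sym → Prog} {S S' : Store} {n : ℕ} (o : Option k.Sym)
    (ho : (S k).head? = o) (h : Runs (f o) S S' n) : Runs (.case k f) S S' (1 + n) := by
  subst ho
  exact Runs.case h

/-- Read the input, as a list on the main stack, in reverse. -/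
def readInput : Prog := .loop .inp Option.isSome (.case .inp fun o => match o with
  | Option.none => .skip
  | Option.some a => .seq (.pop .inp) (.seq (.push (.wk .main) (Option.some a))
      (.push (.wk .main) Option.none)))

theorem runs_readInput (i : List Letter) : ∀ l : List Letter,
    Runs readInput (io i [] [] (code l).word) (io [] [] [] (code (i.reverse ++ l)).word)
      (5 * i.length + 1) := by
  induction i with
  | nil => exact fun l => Runs.loopDone (by simp)
  | cons a i ih =>
    intro l
    refine ((Runs.loopStep (by simp) (Runs.case' (Option.some a) (by simp) ((Runs.pop _ _).seq
      ((Runs.push _ _ _).seq (Runs.push _ _ _)))) ((ih (a :: l)).start ?_)).mono ?_).congr ?_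
    · simp [code_cons, code_letter, BTree.word]
    · simp; omega
    · simp

/-- Write a list of letters to the output, in reverse. -/
def writeWord : Prog := .loop (.wk .main) isNode (.seq (.pop (.wk .main)) (.case (.wk .main)
  fun o => match o with
  | Option.some (Option.some a) => .seq (.pop (.wk .main)) (.push .outW a)
  | _ => .skip))

theorem runs_writeWord (l : List Letter) : ∀ o : List Letter,
    Runs writeWord (io [] o [] (code l).word)
      (io [] (l.reverse ++ o) [] (code ([] : List Letter)).word) (5 * l.length + 1) := by
  induction l with
  | nil => exact fun o => Runs.loopDone rfl
  | cons a l ih =>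
    intro o
    refine ((Runs.loopStep rfl ((Runs.pop _ _).seq (Runs.case' (Option.some (Option.some a)) ?_
      ((Runs.pop _ _).seq (Runs.push _ _ _)))) ((ih (a :: o)).start ?_)).mono ?_).congr ?_
    · simp [code_cons, code_letter, BTree.word]
    · simp [code_cons, code_letter, BTree.word]
    · simp; omega
    · simp

/-- Write a truth value to the output. -/
def writeBool : Prog := .case (.wk .main) fun o => match o with
  | Option.some (Option.some (.bit b)) => .seq (.pop (.wk .main)) (.push .outB b)
  | _ => .skip

theorem runs_writeBool (b : Bool) :
    Runs writeBool (io [] [] [] (code b).word) (io [] [] [b] []) 3 := by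
  have h := (Runs.pop (.wk .main) (io [] [] [] (code b).word)).seq (Runs.push .outB b _)
  have h' : Runs writeBool (io [] [] [] (code b).word) _ _ :=
    Runs.case' (Option.some (Option.some (Letter.bit b))) (by simp [code_bool, BTree.word]) h
  exact h'.congr (by simp [code_bool, BTree.word])

/-- Data coded by the list of letters (in reverse) which the machines read. -/
structure Inp {α : Type} (ea : α → List Letter) : Type where
  val : α

instance {α : Type} (ea : α → List Letter) : Code (Inp ea) := ⟨fun x => code (ea x.val).reverse⟩

theorem sz_letters (l : List Letter) : sz l = 2 * l.length + 1 := by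
  induction l with
  | nil => rfl
  | cons a l ih => simp [ih]; omega

theorem sz_inp {α : Type} {ea : α → List Letter} (x : Inp ea) :
    sz x = 2 * (ea x.val).length + 1 := by
  have := sz_letters (ea x.val).reverse
  rw [List.length_reverse] at this
  exact this

/-- Reading the input onto the main stack reverses it, and so does writing the output; hence the
reversed words in the coding of `Inp` and in the hypothesis. A list of n letters has a code of size
2n + 1, which is the argument given to `p` and `q`. -/
theorem polyTime_word {α β : Type} {ea : α → List Letter} {eb : β → List Letter} {f : α → β}
    (hf : FP fun x : Inp ea => (eb (f x.val)).reverse) :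
    Nonempty (Turing.TM2ComputableInPolyTime ea eb f) := by
  obtain ⟨q, hq⟩ := hf.sz_le
  obtain ⟨c, p, h⟩ := hf
  -- The end marker pushed first is the code of the empty list, onto which the letters are then
  -- stacked.
  refine polyTime_of_run (.seq (.push (.wk .main) (Option.some .endMark)) (.seq readInput
    (.seq c (.seq writeWord (.pop (.wk .main)))))) .inp .outW (Equiv.refl _) (Equiv.refl _)
    (5 * Polynomial.X + p.comp (2 * Polynomial.X + 1) +
      5 * q.comp (2 * Polynomial.X + 1) + 4) fun a => ?_
  have hq' := hq ⟨a⟩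
  refine ((((Runs.push (.wk .main) (Option.some .endMark) (io (ea a) [] [] [])).seq
    (((runs_readInput (ea a) []).start ?_).seq
    (((h ⟨a⟩ [] []).start ?_).seq (((runs_writeWord (eb (f a)).reverse []).start ?_).seq
    (Runs.pop _ _))))).mono ?_).start ?_).congr ?_
  · simp [code_nil, BTree.word]
  · rw [store_nil]; simp [code]
  · rw [store_nil]; simp
  · simp only [sz_inp, sz_letters, List.length_reverse] at *
    simp
    omega
  · rw [single_inp]; simp
  · rw [single_outW]; simp [code_nil, BTree.word]

theorem polyTime_bool {α : Type} {ea : α → List Letter} {f : α → Bool}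
    (hf : FP fun x : Inp ea => f x.val) :
    Nonempty (Turing.TM2ComputableInPolyTime ea Computability.encodeBool f) := by
  obtain ⟨c, p, h⟩ := hf
  refine polyTime_of_run (.seq (.push (.wk .main) (Option.some .endMark)) (.seq readInput
    (.seq c writeBool))) .inp .outB (Equiv.refl _) (Equiv.refl _)
    (5 * Polynomial.X + p.comp (2 * Polynomial.X + 1) + 5) fun a => ?_
  refine ((((Runs.push (.wk .main) (Option.some .endMark) (io (ea a) [] [] [])).seq
    (((runs_readInput (ea a) []).start ?_).seq
    (((h ⟨a⟩ [] []).start ?_).seq ((runs_writeBool (f a)).start ?_)))).mono ?_).start ?_).congr ?_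
  · simp [code_nil, BTree.word]
  · rw [store_nil]; simp [code]
  · rw [store_nil]; simp
  · simp [sz_inp]
    omega
  · rw [single_inp]; simp
  · rw [single_outB]; simp [Computability.encodeBool]

end Syllogistic

namespace Syllogistic

/-! ### Soundness -/

variable {P R : Type}

/-- Each rule preserves truth in every single model; after unfolding the semantics this is a
first-order check, rule by rule. -/
theorem Model.sat_of_provesIn {A Γ : Set (Sentence P R)} {φ : Sentence P R} (M : Model P R)
    (hM : ∀ ψ ∈ Γ, M.Sat ψ) (h : ProvesIn extendedSystem A Γ φ) : M.Sat φ := by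
  induction h with
  | leaf hΓ _ => exact hM _ hΓ
  | node ρ hρ σ _ _ ih =>
    simp only [extendedSystem, List.mem_cons, List.not_mem_nil, or_false] at hρ
    rcases hρ with rfl | rfl | rfl | rfl | rfl | rfl | rfl | rfl | rfl | rfl | rfl | rfl | rfl |
      rfl | rfl | rfl
    all_goals
      -- No rule has more than three premises.
      try obtain ⟨h₁, ih⟩ := List.forall_mem_cons.1 ih
      try obtain ⟨h₂, ih⟩ := List.forall_mem_cons.1 ih
      try obtain ⟨h₃, ih⟩ := List.forall_mem_cons.1 ih
      clear ih
      simp only [ruleAxiom, ruleBarbara, ruleAnti, ruleSome1, ruleSome2, ruleDarii, ruleEmpty1,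
        ruleEmpty2, ruleOrSome1, ruleOrSome2, ruleLeftWeakening, ruleRightWeakening,
        ruleOrBarbara, ruleOrAnti, ruleDoubleDarii, ruleOrDoubleDarii, Substitution.onSentence,
        Substitution.onTerm, Model.Sat, Model.interp, Set.subset_def, Set.Nonempty,
        Set.mem_inter_iff, Set.mem_ofPred_eq] at *
      clear hM
      grind

theorem sound_extendedSystem : Sound P R extendedSystem :=
  fun _ _ h M hM => M.sat_of_provesIn hM h

/-! ### The canonical model -/

/-- Given a relation `le` between terms and a set `G` of pairs of terms which shall have no
instance in common: an element below both `u` and `v` would be a common instance of such a pair. -/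
def Bad (le : Term P R → Term P R → Prop) (G : Set (Term P R × Term P R)) (u v : Term P R) : Prop :=
  ∃ p ∈ G, (le u p.1 ∨ le v p.1) ∧ (le u p.2 ∨ le v p.2)

/-- The closure properties of the relation `le` which are needed for the canonical model. -/
structure Saturated (T : Set (Term P R)) (le : Term P R → Term P R → Prop)
    (G : Set (Term P R × Term P R)) : Prop where
  refl : ∀ a ∈ T, le a a
  mem : ∀ a b, le a b → a ∈ T ∧ b ∈ T
  trans : ∀ a b c, le a b → le b c → le a c
  anti : ∀ r a b, Term.rAll r a ∈ T → Term.rAll r b ∈ T → le a b → le (.rAll r b) (.rAll r a)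
  of_bad : ∀ a ∈ T, ∀ b ∈ T, Bad le G a a → le a b
  rAll_of_bad : ∀ r a, Term.rAll r a ∈ T → ∀ b ∈ T, Bad le G a a → le b (.rAll r a)

/-- The canonical model: its elements are pairs of terms, regarded as common instances. -/
def canonicalModel (T : Set (Term P R)) (le : Term P R → Term P R → Prop)
    (G : Set (Term P R × Term P R)) : Model P R where
  carrier := {m : Term P R × Term P R // m.1 ∈ T ∧ m.2 ∈ T ∧ ¬ Bad le G m.1 m.2}
  noun p := {m | le m.1.1 (.noun p) ∨ le m.1.2 (.noun p)}
  verb r m n := ∃ t, (le m.1.1 (.rAll r t) ∨ le m.1.2 (.rAll r t)) ∧ (le n.1.1 t ∨ le n.1.2 t)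

namespace Saturated

variable {T : Set (Term P R)} {le : Term P R → Term P R → Prop} {G : Set (Term P R × Term P R)}

/-- By transitivity, whatever lies above `u` or `v` also lies above `m` or `n`. -/
theorem bad_of_le (h : Saturated T le G) {u v m n : Term P R} (hb : Bad le G u v)
    (hu : le m u ∨ le n u) (hv : le m v ∨ le n v) : Bad le G m n := by
  obtain ⟨p, hp, h₁, h₂⟩ := hb
  have key : ∀ w, (le u w ∨ le v w) → (le m w ∨ le n w) := by
    rintro w (hw | hw)
    · exact hu.imp (fun h' => h.trans _ _ _ h' hw) (fun h' => h.trans _ _ _ h' hw)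
    · exact hv.imp (fun h' => h.trans _ _ _ h' hw) (fun h' => h.trans _ _ _ h' hw)
  exact ⟨p, hp, key _ h₁, key _ h₂⟩

/-- The truth lemma. For `r all t`, suppose that `m` is related to all instances of `t`. If the pair
`(t, t)` is an element, the relation of `m` to it yields some `s` above `t` with `r all s` above
`m`, and `anti` gives `r all s` below `r all t`. If the pair is bad, `rAll_of_bad` places all of `T`
below `r all t`. -/
theorem mem_interp (h : Saturated T le G) (hT : ∀ r a, Term.rAll r a ∈ T → a ∈ T)
    (t : Term P R) : t ∈ T → ∀ m : (canonicalModel T le G).carrier,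
      m ∈ (canonicalModel T le G).interp t ↔ le m.1.1 t ∨ le m.1.2 t := by
  induction t with
  | noun p => exact fun _ m => Iff.rfl
  | rAll r t ih =>
    intro ht m
    have htT := hT r t ht
    have ih := ih htT
    constructor
    · intro hm
      by_cases hb : Bad le G t t
      · exact Or.inl (h.rAll_of_bad r t ht _ m.2.1 hb)
      · obtain ⟨s, hs, hts⟩ := hm ⟨(t, t), htT, htT, hb⟩ ((ih _).mpr (Or.inl (h.refl t htT)))
        have hts : le t s := or_self_iff.mp hts
        have hsT : Term.rAll r s ∈ T := hs.elim (fun h' => (h.mem _ _ h').2)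
          fun h' => (h.mem _ _ h').2
        have := h.anti r t s ht hsT hts
        exact hs.imp (fun h' => h.trans _ _ _ h' this) (fun h' => h.trans _ _ _ h' this)
    · exact fun hm n hn => ⟨t, hm, (ih n).mp hn⟩

/-- The inclusion is tested on `(a, a)`, the generic instance of `a`. If that pair is bad, then
`of_bad` already puts `a` below `b`. -/
theorem sat_all (h : Saturated T le G) (hT : ∀ r a, Term.rAll r a ∈ T → a ∈ T) {a b : Term P R}
    (ha : a ∈ T) (hb : b ∈ T) : (canonicalModel T le G).Sat (.all a b) ↔ le a b := by
  constructor
  · intro hs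
    by_cases hbad : Bad le G a a
    · exact h.of_bad _ ha _ hb hbad
    · have := @hs ⟨(a, a), ha, ha, hbad⟩
        ((h.mem_interp hT a ha _).mpr (Or.inl (h.refl a ha)))
      exact or_self_iff.mp ((h.mem_interp hT b hb _).mp this)
  · intro hab m hm
    rw [h.mem_interp hT a ha] at hm
    rw [h.mem_interp hT b hb]
    exact hm.imp (fun h' => h.trans _ _ _ h' hab) (fun h' => h.trans _ _ _ h' hab)

/-- A pair which is not bad is its own witness. Conversely, any common instance of `u` and `v` would
inherit the badness of the pair, by `bad_of_le`. -/
theorem sat_some (h : Saturated T le G) (hT : ∀ r a, Term.rAll r a ∈ T → a ∈ T) {u v : Term P R}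
    (hu : u ∈ T) (hv : v ∈ T) : (canonicalModel T le G).Sat (.some u v) ↔ ¬ Bad le G u v := by
  constructor
  · rintro ⟨m, hmu, hmv⟩ hbad
    rw [h.mem_interp hT u hu] at hmu
    rw [h.mem_interp hT v hv] at hmv
    exact m.2.2.2 (h.bad_of_le hbad hmu hmv)
  · intro hbad
    exact ⟨⟨(u, v), hu, hv, hbad⟩, (h.mem_interp hT u hu _).mpr (Or.inl (h.refl u hu)),
      (h.mem_interp hT v hv _).mpr (Or.inr (h.refl v hv))⟩

end Saturated

/-! ### The set `g Δ` -/

section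
variable {Δ : Set (Sentence P R)} {a b x y : Term P R}

theorem Term.mem_subterms_self (t : Term P R) : t ∈ t.subterms := by
  cases t <;> simp [subterms]

theorem Term.subterms_rAll {r : R} {x t : Term P R} (h : Term.rAll r x ∈ t.subterms) :
    x ∈ t.subterms := by
  induction t with
  | noun p => simp [subterms] at h
  | rAll s t ih =>
    simp only [subterms, Set.mem_insert_iff, Term.rAll.injEq] at h ⊢
    rcases h with ⟨_, rfl⟩ | h
    · exact Or.inr (mem_subterms_self _)
    · exact Or.inr (ih h)

theorem mem_subtermsOf_of_rAll {r : R} (h : Term.rAll r x ∈ subtermsOf Δ) : x ∈ subtermsOf Δ := by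
  obtain ⟨ψ, hψ, t, ht, hx⟩ := h
  exact ⟨ψ, hψ, t, ht, Term.subterms_rAll hx⟩

theorem mem_subtermsOf {ψ : Sentence P R} (hψ : ψ ∈ Δ) (hx : x ∈ ψ.constituents) :
    x ∈ subtermsOf Δ := ⟨ψ, hψ, x, hx, x.mem_subterms_self⟩

theorem all_mem_g (ha : a ∈ subtermsOf Δ) (hb : b ∈ subtermsOf Δ) : Sentence.all a b ∈ g Δ :=
  Or.inl ⟨a, ha, b, Or.inl hb, rfl⟩

theorem some_mem_g (hx : x ∈ subtermsOf Δ) (hy : y ∈ subtermsOf Δ) : Sentence.some x y ∈ g Δ :=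
  Or.inr (Or.inl ⟨x, hx, y, hy, rfl⟩)

theorem allOrSome_mem_g (ha : a ∈ subtermsOf Δ) (hb : b ∈ subtermsOf Δ) (hx : x ∈ subtermsOf Δ)
    (hy : y ∈ subtermsOf Δ) : Sentence.allOrSome a b x y ∈ g Δ :=
  Or.inr (Or.inr ⟨a, ha, b, Or.inl hb, x, hx, y, hy, rfl⟩)

theorem mem_g {ψ : Sentence P R} (h : ψ ∈ Δ) : ψ ∈ g Δ := by
  cases ψ <;>
    first
    | exact all_mem_g (mem_subtermsOf h (by simp [Sentence.constituents]))
        (mem_subtermsOf h (by simp [Sentence.constituents]))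
    | exact some_mem_g (mem_subtermsOf h (by simp [Sentence.constituents]))
        (mem_subtermsOf h (by simp [Sentence.constituents]))
    | exact allOrSome_mem_g (mem_subtermsOf h (by simp [Sentence.constituents]))
        (mem_subtermsOf h (by simp [Sentence.constituents]))
        (mem_subtermsOf h (by simp [Sentence.constituents]))
        (mem_subtermsOf h (by simp [Sentence.constituents]))

end

/-! ### The rules -/

namespace ProvesIn

variable {A Γ : Set (Sentence P R)} {a b c t u x y : Term P R} {r : R}

local notation "Pr" => ProvesIn extendedSystem A Γ

/-- A proof by a rule without noun and sentence variables. -/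
theorem of_rule (ρ : Rule) (hρ : ρ ∈ extendedSystem) (hn : ρ.nouns = 0) (hs : ρ.sentences = 0)
    (f : Fin ρ.verbs → R) (s : Fin ρ.terms → Term P R) {φ : Sentence P R}
    (hφ : φ = (⟨fun i => (hn ▸ i).elim0, f, s, fun i => (hs ▸ i).elim0⟩ :
      Substitution ρ P R).onSentence ρ.conclusion)
    (hprem : ∀ θ ∈ ρ.premises, Pr ((⟨fun i => (hn ▸ i).elim0, f, s, fun i => (hs ▸ i).elim0⟩ :
      Substitution ρ P R).onSentence θ)) (hA : φ ∈ A) : Pr φ := by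
  subst hφ
  exact .node ρ hρ _ hprem hA

theorem all_refl (hA : .all x x ∈ A) : Pr (.all x x) :=
  of_rule ruleAxiom (by simp [extendedSystem]) rfl rfl Fin.elim0 ![x] rfl (List.forall_mem_nil _) hA

theorem barbara (h₁ : Pr (.all a b)) (h₂ : Pr (.all b c)) (hA : .all a c ∈ A) :
    Pr (.all a c) :=
  of_rule ruleBarbara (by simp [extendedSystem]) rfl rfl Fin.elim0 ![a, b, c] rfl
    (List.forall_mem_cons.2 ⟨h₁, List.forall_mem_cons.2 ⟨h₂, List.forall_mem_nil _⟩⟩) hA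

theorem anti (h₁ : Pr (.all a b)) (hA : .all (.rAll r b) (.rAll r a) ∈ A) :
    Pr (.all (.rAll r b) (.rAll r a)) :=
  of_rule ruleAnti (by simp [extendedSystem]) rfl rfl ![r] ![a, b] rfl
    (List.forall_mem_cons.2 ⟨h₁, List.forall_mem_nil _⟩) hA

theorem empty1 (hA : .allOrSome a b a a ∈ A) : Pr (.allOrSome a b a a) :=
  of_rule ruleEmpty1 (by simp [extendedSystem]) rfl rfl Fin.elim0 ![a, b] rfl
    (List.forall_mem_nil _) hA

theorem empty2 (hA : .allOrSome b (.rAll r a) a a ∈ A) : Pr (.allOrSome b (.rAll r a) a a) :=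
  of_rule ruleEmpty2 (by simp [extendedSystem]) rfl rfl ![r] ![a, b] rfl
    (List.forall_mem_nil _) hA

theorem some1 (h₁ : Pr (.some x y)) (hA : .some x x ∈ A) : Pr (.some x x) :=
  of_rule ruleSome1 (by simp [extendedSystem]) rfl rfl Fin.elim0 ![x, y] rfl
    (List.forall_mem_cons.2 ⟨h₁, List.forall_mem_nil _⟩) hA

theorem some2 (h₁ : Pr (.some x y)) (hA : .some y x ∈ A) : Pr (.some y x) :=
  of_rule ruleSome2 (by simp [extendedSystem]) rfl rfl Fin.elim0 ![x, y] rfl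
    (List.forall_mem_cons.2 ⟨h₁, List.forall_mem_nil _⟩) hA

theorem orSome1 (h₁ : Pr (.allOrSome a b x y)) (hA : .allOrSome a b x x ∈ A) :
    Pr (.allOrSome a b x x) :=
  of_rule ruleOrSome1 (by simp [extendedSystem]) rfl rfl Fin.elim0 ![a, b, x, y] rfl
    (List.forall_mem_cons.2 ⟨h₁, List.forall_mem_nil _⟩) hA

theorem orSome2 (h₁ : Pr (.allOrSome a b x y)) (hA : .allOrSome a b y x ∈ A) :
    Pr (.allOrSome a b y x) :=
  of_rule ruleOrSome2 (by simp [extendedSystem]) rfl rfl Fin.elim0 ![a, b, x, y] rfl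
    (List.forall_mem_cons.2 ⟨h₁, List.forall_mem_nil _⟩) hA

theorem leftWeakening (h₁ : Pr (.all a b)) (hA : .allOrSome a b x y ∈ A) :
    Pr (.allOrSome a b x y) :=
  of_rule ruleLeftWeakening (by simp [extendedSystem]) rfl rfl Fin.elim0 ![a, b, x, y] rfl
    (List.forall_mem_cons.2 ⟨h₁, List.forall_mem_nil _⟩) hA

theorem rightWeakening (h₁ : Pr (.some x y)) (hA : .allOrSome a b x y ∈ A) :
    Pr (.allOrSome a b x y) :=
  of_rule ruleRightWeakening (by simp [extendedSystem]) rfl rfl Fin.elim0 ![a, b, x, y] rfl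
    (List.forall_mem_cons.2 ⟨h₁, List.forall_mem_nil _⟩) hA

theorem orBarbara (h₁ : Pr (.allOrSome a b x y)) (h₂ : Pr (.allOrSome b c x y))
    (hA : .allOrSome a c x y ∈ A) : Pr (.allOrSome a c x y) :=
  of_rule ruleOrBarbara (by simp [extendedSystem]) rfl rfl Fin.elim0 ![a, b, c, x, y] rfl
    (List.forall_mem_cons.2 ⟨h₁, List.forall_mem_cons.2 ⟨h₂, List.forall_mem_nil _⟩⟩) hA

theorem orAnti (h₁ : Pr (.allOrSome a b x y))
    (hA : .allOrSome (.rAll r b) (.rAll r a) x y ∈ A) :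
    Pr (.allOrSome (.rAll r b) (.rAll r a) x y) :=
  of_rule ruleOrAnti (by simp [extendedSystem]) rfl rfl ![r] ![a, b, x, y] rfl
    (List.forall_mem_cons.2 ⟨h₁, List.forall_mem_nil _⟩) hA

theorem doubleDarii (h₁ : Pr (.some t u)) (h₂ : Pr (.allOrSome t x x y))
    (h₃ : Pr (.allOrSome u y x y)) (hA : .some x y ∈ A) : Pr (.some x y) :=
  of_rule ruleDoubleDarii (by simp [extendedSystem]) rfl rfl Fin.elim0 ![t, u, x, y] rfl
    (List.forall_mem_cons.2 ⟨h₁, List.forall_mem_cons.2 ⟨h₂, List.forall_mem_cons.2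
      ⟨h₃, List.forall_mem_nil _⟩⟩⟩) hA

theorem orDoubleDarii (h₁ : Pr (.allOrSome a b t u)) (h₂ : Pr (.allOrSome t x x y))
    (h₃ : Pr (.allOrSome u y x y)) (hA : .allOrSome a b x y ∈ A) : Pr (.allOrSome a b x y) :=
  of_rule ruleOrDoubleDarii (by simp [extendedSystem]) rfl rfl Fin.elim0 ![a, b, t, u, x, y] rfl
    (List.forall_mem_cons.2 ⟨h₁, List.forall_mem_cons.2 ⟨h₂, List.forall_mem_cons.2
      ⟨h₃, List.forall_mem_nil _⟩⟩⟩) hA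

end ProvesIn

/-! ### Completeness -/

section
variable {Γ : Set (Sentence P R)} {Δ : Set (Sentence P R)}

/-- From a common instance of `u` and `v`, or else `all a b`, to a common instance of `x` and `y`,
or else `all a b`. -/
theorem provesIn_of_bad {x y : Term P R} (hx : x ∈ subtermsOf Δ) (hy : y ∈ subtermsOf Δ)
    {le : Term P R → Term P R → Prop}
    (hle : ∀ a b, le a b → ProvesIn extendedSystem (g Δ) Γ (.allOrSome a b x y))
    {u v : Term P R} (hu : u ∈ subtermsOf Δ) (hv : v ∈ subtermsOf Δ)
    (hbad : Bad le {(x, y)} u v) {a b : Term P R}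
    (ha : a ∈ subtermsOf Δ) (hb : b ∈ subtermsOf Δ)
    (h : ProvesIn extendedSystem (g Δ) Γ (.allOrSome a b u v)) :
    ProvesIn extendedSystem (g Δ) Γ (.allOrSome a b x y) := by
  obtain ⟨p, rfl, h₁, h₂⟩ := hbad
  have hA := allOrSome_mem_g ha hb hx hy
  have hvu := h.orSome2 (allOrSome_mem_g ha hb hv hu)
  -- The cases are which of `u`, `v` lies below `x` and which lies below `y`. Symmetry and
  -- repetition of one term bring the premise into the form required by the rule.
  rcases h₁ with h₁ | h₁ <;> rcases h₂ with h₂ | h₂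
  · exact (h.orSome1 (allOrSome_mem_g ha hb hu hu)).orDoubleDarii (hle _ _ h₁) (hle _ _ h₂) hA
  · exact h.orDoubleDarii (hle _ _ h₁) (hle _ _ h₂) hA
  · exact hvu.orDoubleDarii (hle _ _ h₁) (hle _ _ h₂) hA
  · exact (hvu.orSome1 (allOrSome_mem_g ha hb hv hv)).orDoubleDarii (hle _ _ h₁) (hle _ _ h₂) hA

/-- This serves premises `some u v`, which have no universal disjunct to carry along. -/
theorem provesIn_some_of_bad {x y : Term P R} (hx : x ∈ subtermsOf Δ) (hy : y ∈ subtermsOf Δ)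
    {le : Term P R → Term P R → Prop}
    (hle : ∀ a b, le a b → ProvesIn extendedSystem (g Δ) Γ (.allOrSome a b x y))
    {u v : Term P R} (hu : u ∈ subtermsOf Δ) (hv : v ∈ subtermsOf Δ)
    (hbad : Bad le {(x, y)} u v) (h : ProvesIn extendedSystem (g Δ) Γ (.some u v)) :
    ProvesIn extendedSystem (g Δ) Γ (.some x y) := by
  obtain ⟨p, rfl, h₁, h₂⟩ := hbad
  have hA := some_mem_g hx hy
  have hvu := h.some2 (some_mem_g hv hu)
  rcases h₁ with h₁ | h₁ <;> rcases h₂ with h₂ | h₂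
  · exact (h.some1 (some_mem_g hu hu)).doubleDarii (hle _ _ h₁) (hle _ _ h₂) hA
  · exact h.doubleDarii (hle _ _ h₁) (hle _ _ h₂) hA
  · exact hvu.doubleDarii (hle _ _ h₁) (hle _ _ h₂) hA
  · exact (hvu.some1 (some_mem_g hv hv)).doubleDarii (hle _ _ h₁) (hle _ _ h₂) hA

/-- The relation `all a b or some x y` is provable. -/
def leOr (Γ Δ : Set (Sentence P R)) (x y a b : Term P R) : Prop :=
  a ∈ subtermsOf Δ ∧ b ∈ subtermsOf Δ ∧ ProvesIn extendedSystem (g Δ) Γ (.allOrSome a b x y)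

/-- Reflexivity, transitivity and antitonicity are rules with `or some x y` carried along. In the
last two clauses, the axioms for an empty term offer `some a a` as their alternative, and badness of
`(a, a)` converts this alternative into `some x y`. -/
theorem saturated_leOr {x y : Term P R} (hx : x ∈ subtermsOf Δ) (hy : y ∈ subtermsOf Δ) :
    Saturated (subtermsOf Δ) (leOr Γ Δ x y) {(x, y)} where
  refl _ ha := ⟨ha, ha, (ProvesIn.all_refl (all_mem_g ha ha)).leftWeakening
    (allOrSome_mem_g ha ha hx hy)⟩
  mem _ _ h := ⟨h.1, h.2.1⟩
  trans _ _ _ h h' := ⟨h.1, h'.2.1, h.2.2.orBarbara h'.2.2 (allOrSome_mem_g h.1 h'.2.1 hx hy)⟩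
  anti _ _ _ ha hb h := ⟨hb, ha, h.2.2.orAnti (allOrSome_mem_g hb ha hx hy)⟩
  of_bad _ ha _ hb h := ⟨ha, hb, provesIn_of_bad hx hy (fun _ _ h => h.2.2) ha ha h ha hb
    (.empty1 (allOrSome_mem_g ha hb ha ha))⟩
  rAll_of_bad _ _ ha _ hb h := ⟨hb, ha, provesIn_of_bad hx hy (fun _ _ h => h.2.2)
    (mem_subtermsOf_of_rAll ha) (mem_subtermsOf_of_rAll ha) h hb ha
    (.empty2 (allOrSome_mem_g hb ha (mem_subtermsOf_of_rAll ha) (mem_subtermsOf_of_rAll ha)))⟩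

/-- Either `some x y` is provable, or the canonical model satisfies the premises. -/
theorem provesIn_or_sat {x y : Term P R} (hx : x ∈ subtermsOf Δ) (hy : y ∈ subtermsOf Δ)
    (hΓ : Γ ⊆ Δ) : ProvesIn extendedSystem (g Δ) Γ (.some x y) ∨
      ∀ ψ ∈ Γ, (canonicalModel (subtermsOf Δ) (leOr Γ Δ x y) {(x, y)}).Sat ψ := by
  by_contra! hcon
  obtain ⟨hn, ψ, hψ, hsat⟩ := hcon
  have hs := saturated_leOr (Γ := Γ) hx hy
  have hT : ∀ (r : R) a, Term.rAll r a ∈ subtermsOf Δ → a ∈ subtermsOf Δ :=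
    fun _ _ => mem_subtermsOf_of_rAll
  have hm : ∀ t ∈ ψ.constituents, t ∈ subtermsOf Δ := fun t ht => mem_subtermsOf (hΓ hψ) ht
  have hp := ProvesIn.leaf (S := extendedSystem) hψ (mem_g (hΓ hψ))
  cases ψ with
  | all a b =>
    have ha := hm a (by simp [Sentence.constituents])
    have hb := hm b (by simp [Sentence.constituents])
    exact hsat ((hs.sat_all hT ha hb).mpr
      ⟨ha, hb, hp.leftWeakening (allOrSome_mem_g ha hb hx hy)⟩)
  | some u v =>
    have hu := hm u (by simp [Sentence.constituents])
    have hv := hm v (by simp [Sentence.constituents])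
    rw [hs.sat_some hT hu hv, not_not] at hsat
    exact hn (provesIn_some_of_bad hx hy (fun _ _ h => h.2.2) hu hv hsat hp)
  | allOrSome a b u v =>
    have ha := hm a (by simp [Sentence.constituents])
    have hb := hm b (by simp [Sentence.constituents])
    have hu := hm u (by simp [Sentence.constituents])
    have hv := hm v (by simp [Sentence.constituents])
    have hsat₁ : ¬ (canonicalModel (subtermsOf Δ) (leOr Γ Δ x y) {(x, y)}).Sat (.all a b) :=
      fun h => hsat (Or.inl h)
    have hsat₂ : ¬ (canonicalModel (subtermsOf Δ) (leOr Γ Δ x y) {(x, y)}).Sat (.some u v) :=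
      fun h => hsat (Or.inr h)
    rw [hs.sat_some hT hu hv, not_not] at hsat₂
    exact hsat₁ ((hs.sat_all hT ha hb).mpr ⟨ha, hb,
      provesIn_of_bad hx hy (fun _ _ h => h.2.2) hu hv hsat₂ ha hb hp⟩)

/-- When `φ` has a disjunct `some x y`, the canonical model of `leOr` refutes that disjunct. Hence
either `some x y` is provable outright, or the model satisfies `Γ` and the universal disjunct of `φ`
must hold in it, which means that `φ` is provable. -/
theorem provesIn_of_entails {φ : Sentence P R} (h : Entails Γ φ) :
    ProvesIn extendedSystem (g (insert φ Γ)) Γ φ := by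
  have hm : ∀ t ∈ φ.constituents, t ∈ subtermsOf (insert φ Γ) :=
    fun t ht => mem_subtermsOf (Set.mem_insert _ _) ht
  have hT : ∀ (r : R) a, Term.rAll r a ∈ subtermsOf (insert φ Γ) → a ∈ subtermsOf (insert φ Γ) :=
    fun _ _ => mem_subtermsOf_of_rAll
  have hΓ : Γ ⊆ insert φ Γ := Set.subset_insert _ _
  generalize hΔ : insert φ Γ = Δ at *
  cases φ with
  | some x y =>
    have hx := hm x (by simp [Sentence.constituents])
    have hy := hm y (by simp [Sentence.constituents])
    have hs := saturated_leOr (Γ := Γ) hx hy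
    rcases provesIn_or_sat hx hy hΓ with h' | h'
    · exact h'
    -- The pair `(x, y)` is bad by reflexivity.
    · exact absurd ⟨(x, y), rfl, Or.inl (hs.refl x hx), Or.inr (hs.refl y hy)⟩
        ((hs.sat_some hT hx hy).mp (h _ h'))
  | allOrSome a b x y =>
    have ha := hm a (by simp [Sentence.constituents])
    have hb := hm b (by simp [Sentence.constituents])
    have hx := hm x (by simp [Sentence.constituents])
    have hy := hm y (by simp [Sentence.constituents])
    have hs := saturated_leOr (Γ := Γ) hx hy
    rcases provesIn_or_sat hx hy hΓ with h' | h'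
    · exact h'.rightWeakening (allOrSome_mem_g ha hb hx hy)
    · rcases h _ h' with h | h
      · exact ((hs.sat_all hT ha hb).mp h).2.2
      · exact absurd ⟨(x, y), rfl, Or.inl (hs.refl x hx), Or.inr (hs.refl y hy)⟩
          ((hs.sat_some hT hx hy).mp h)
  | all a b =>
    have ha := hm a (by simp [Sentence.constituents])
    have hb := hm b (by simp [Sentence.constituents])
    let le : Term P R → Term P R → Prop := fun a b => a ∈ subtermsOf Δ ∧ b ∈ subtermsOf Δ ∧
      ProvesIn extendedSystem (g Δ) Γ (.all a b)
    -- With no forbidden pairs nothing is bad, so every existential sentence over these terms holds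
    -- in the model, and only premises `all a b` depend on `le`.
    have hnb : ∀ u v, ¬ Bad le ∅ u v := fun u v ⟨p, hp, _⟩ => hp
    have hs : Saturated (subtermsOf Δ) le ∅ :=
      { refl := fun _ ha => ⟨ha, ha, .all_refl (all_mem_g ha ha)⟩
        mem := fun _ _ h => ⟨h.1, h.2.1⟩
        trans := fun _ _ _ h h' => ⟨h.1, h'.2.1, h.2.2.barbara h'.2.2 (all_mem_g h.1 h'.2.1)⟩
        anti := fun _ _ _ ha hb h => ⟨hb, ha, h.2.2.anti (all_mem_g hb ha)⟩
        of_bad := fun a _ _ _ h => absurd h (hnb a a)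
        rAll_of_bad := fun _ a _ _ _ h => absurd h (hnb a a) }
    refine ((hs.sat_all hT ha hb).mp (h _ fun ψ hψ => ?_)).2.2
    have hm : ∀ t ∈ ψ.constituents, t ∈ subtermsOf Δ := fun t ht => mem_subtermsOf (hΓ hψ) ht
    cases ψ with
    | all a b =>
      have ha := hm a (by simp [Sentence.constituents])
      have hb := hm b (by simp [Sentence.constituents])
      exact (hs.sat_all hT ha hb).mpr ⟨ha, hb, .leaf hψ (mem_g (hΓ hψ))⟩
    | some u v =>
      exact (hs.sat_some hT (hm u (by simp [Sentence.constituents]))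
        (hm v (by simp [Sentence.constituents]))).mpr (hnb u v)
    | allOrSome a b u v =>
      exact Or.inr ((hs.sat_some hT (hm u (by simp [Sentence.constituents]))
        (hm v (by simp [Sentence.constituents]))).mpr (hnb u v))

end

end Syllogistic

namespace Syllogistic

open Code

/-! ### Reading words -/

/-- Injective naming by binary words. -/
class Named (P : Type) where
  name : P → List Bool
  name_injective : Function.Injective name

open Named

/-- Sentences as the machines see them: the list of the pairs `(a, b)` with disjunct `all a b`,
and the list of the pairs `(x, y)` with disjunct `some x y`. -/
abbrev RawSentence : Type :=
  List (List Letter × List Letter) × List (List Letter × List Letter)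

/-- The state of the parser: a name, a stack of terms, the sentences before and after the
turnstile, all the terms, and the pairs `(r, x)` for all the terms `r all x`. -/
abbrev ParserState : Type :=
  List Letter × List (List Letter) × List RawSentence × List RawSentence ×
    List (List Letter) × List (List Letter × List Letter)

/-- One step of the parser, which reads words from the right. -/
def readLetter : Letter → ParserState → ParserState
  | .bit b, (n, st, ψs, φs, ts, ds) => (.bit b :: n, st, ψs, φs, ts, ds)
  | .endMark, (_, st, ψs, φs, ts, ds) => ([.endMark], st, ψs, φs, ts, ds)
  | .noun, (n, st, ψs, φs, ts, ds) =>
      ([], (.noun :: n) :: st, ψs, φs, (.noun :: n) :: ts, ds)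
  | .verb, (n, st, ψs, φs, ts, ds) =>
      ([], (.verb :: (n ++ st.headD [])) :: st.tail, ψs, φs,
        (.verb :: (n ++ st.headD [])) :: ts, (n, st.headD []) :: ds)
  | .all, (n, st, ψs, φs, ts, ds) =>
      (n, st.tail.tail, ([(st.headD [], st.tail.headD [])], []) :: ψs, φs, ts, ds)
  | .some, (n, st, ψs, φs, ts, ds) =>
      (n, st.tail.tail, ([], [(st.headD [], st.tail.headD [])]) :: ψs, φs, ts, ds)
  | .allOrSome, (n, st, ψs, φs, ts, ds) =>
      (n, st.tail.tail.tail.tail, ([(st.headD [], st.tail.headD [])],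
        [(st.tail.tail.headD [], st.tail.tail.tail.headD [])]) :: ψs, φs, ts, ds)
  | .turnstile, (n, st, ψs, _, ts, ds) => (n, st, [], ψs, ts, ds)

/-- The initial state of the parser. -/
def parserInit : ParserState := ([], [], [], [], [], [])

theorem sz_headD_tail {α : Type} [Code α] (l : List (List α)) :
    sz (l.headD []) + sz l.tail ≤ sz l + 1 := by
  cases l with
  | nil => simp
  | cons a l => simp; omega

/-- Name and term stack together gain at most a constant per letter, because their contents are only
rearranged. A letter may also copy terms to the other lists, so the whole state gains up to a
multiple of their size. Over a whole word the growth is therefore quadratic. -/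
theorem sz_readLetter (a : Letter) (s : ParserState) :
    sz (readLetter a s).1 + sz (readLetter a s).2.1 ≤ sz s.1 + sz s.2.1 + 10 ∧
    sz (readLetter a s) ≤ sz s + (10 * (sz s.1 + sz s.2.1) + 50) := by
  obtain ⟨n, st, ψs, φs, ts, ds⟩ := s
  have h₁ := sz_headD_tail st
  have h₂ := sz_headD_tail st.tail
  have h₃ := sz_headD_tail st.tail.tail
  have h₄ := sz_headD_tail st.tail.tail.tail
  have h₅ := sz_append n (st.headD [])
  have h₆ := one_le_sz (st.headD [])
  have h₇ := one_le_sz (st.tail.headD [])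
  have h₈ := one_le_sz (st.tail.tail.headD [])
  have h₉ := one_le_sz (st.tail.tail.tail.headD [])
  have h₀ := one_le_sz n
  cases a <;> simp only [readLetter, sz_mk, sz_cons, sz_nil, sz_letter] <;> constructor <;> omega

theorem sz_foldl_readLetter (l : List Letter) : ∀ s : ParserState,
    sz (l.foldl (fun s a => readLetter a s) s) ≤
      sz s + l.length * (10 * (sz s.1 + sz s.2.1 + 10 * l.length) + 50) := by
  induction l with
  | nil => simp
  | cons a l ih =>
    intro s
    obtain ⟨h₁, h₂⟩ := sz_readLetter a s
    have h₃ := ih (readLetter a s)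
    have h₄ : l.length * (10 * (sz (readLetter a s).1 + sz (readLetter a s).2.1 +
        10 * l.length) + 50) ≤
        l.length * (10 * (sz s.1 + sz s.2.1 + 10 * (l.length + 1)) + 50) :=
      Nat.mul_le_mul_left _ (by omega)
    rw [List.foldl_cons, List.length_cons, Nat.add_mul l.length]
    omega

theorem FP.readLetters {α : Type} [Code α] {l : α → List Letter} (hl : FP l) :
    FP (fun x => (l x).foldl (fun s a => readLetter a s) parserInit) := by
  obtain ⟨q, hq⟩ := hl.sz_le
  refine FP.foldl hl (FP.const _) (FP.letterCases
    (l := fun a : α × ParserState × Letter => a.2.2)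
    (F := fun b a => readLetter b a.2.1) (by fun_prop) fun b => ?_)
    ⟨Polynomial.C (sz parserInit) + q * (10 * (4 + 10 * q) + 50), fun x l' hl' => ?_⟩
  · cases b <;> simp only [readLetter] <;> fun_prop
  · have h₁ := sz_foldl_readLetter l' parserInit
    have h₂ : l'.length ≤ q.eval (sz x) :=
      hl'.length_le.trans ((length_lt_sz _).le.trans (hq x))
    have h₃ : l'.length * (10 * (sz parserInit.1 + sz parserInit.2.1 + 10 * l'.length) + 50) ≤
        q.eval (sz x) * (10 * (4 + 10 * q.eval (sz x)) + 50) :=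
      Nat.mul_le_mul h₂ (by simp [parserInit]; omega)
    simp only [Polynomial.eval_add, Polynomial.eval_mul, Polynomial.eval_C,
      Polynomial.eval_ofNat]
    omega

/-! ### Terms and sentences as data -/

section
variable {P R : Type}

/-- The list of subterms. -/
def Term.subs : Term P R → List (Term P R)
  | .noun p => [.noun p]
  | .rAll r x => .rAll r x :: x.subs

/-- The list of the pairs `(r, x)` for all the subterms `r all x`. -/
def Term.rAlls : Term P R → List (R × Term P R)
  | .noun _ => []
  | .rAll r x => (r, x) :: x.rAlls

/-- The pairs `(a, b)` with disjunct `all a b`. -/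
def Sentence.alls : Sentence P R → List (Term P R × Term P R)
  | .all x y => [(x, y)]
  | .some _ _ => []
  | .allOrSome a b _ _ => [(a, b)]

/-- The pairs `(x, y)` with disjunct `some x y`. -/
def Sentence.somes : Sentence P R → List (Term P R × Term P R)
  | .all _ _ => []
  | .some x y => [(x, y)]
  | .allOrSome _ _ x y => [(x, y)]

/-- The immediate constituents, as a list. -/
def Sentence.parts : Sentence P R → List (Term P R)
  | .all x y => [x, y]
  | .some x y => [x, y]
  | .allOrSome a b x y => [a, b, x, y]

/-- All subterms of a list of sentences. -/
def subsOf (L : List (Sentence P R)) : List (Term P R) :=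
  L.flatMap fun ψ => ψ.parts.flatMap Term.subs

/-- The pairs `(r, x)` for all the subterms `r all x` of a list of sentences. -/
def rAllsOf (L : List (Sentence P R)) : List (R × Term P R) :=
  L.flatMap fun ψ => ψ.parts.flatMap Term.rAlls

theorem Term.mem_subs {t x : Term P R} : x ∈ t.subs ↔ x ∈ t.subterms := by
  induction t with
  | noun p => simp [subs, subterms]
  | rAll r t ih => simp [subs, subterms, ih]

theorem Term.mem_rAlls {t x : Term P R} {r : R} :
    (r, x) ∈ t.rAlls ↔ Term.rAll r x ∈ t.subterms := by
  induction t with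
  | noun p => simp [rAlls, subterms]
  | rAll s t ih => simp [rAlls, subterms, ih]

theorem Sentence.mem_parts {ψ : Sentence P R} {x : Term P R} :
    x ∈ ψ.parts ↔ x ∈ ψ.constituents := by
  cases ψ <;> simp [parts, constituents]

theorem mem_subsOf {L : List (Sentence P R)} {x : Term P R} :
    x ∈ subsOf L ↔ x ∈ subtermsOf {ψ | ψ ∈ L} := by
  simp [subsOf, subtermsOf, Term.mem_subs, Sentence.mem_parts]

theorem mem_rAllsOf {L : List (Sentence P R)} {x : Term P R} {r : R} :
    (r, x) ∈ rAllsOf L ↔ Term.rAll r x ∈ subtermsOf {ψ | ψ ∈ L} := by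
  simp [rAllsOf, subtermsOf, Term.mem_rAlls, Sentence.mem_parts]

end

/-! ### Codes of names, terms and sentences. -/

section
variable {P R : Type} [Named P] [Named R]

/-- The word for a name. -/
def nameWord (p : P) : List Letter := encodeName (name p)

/-- The word for a term. -/
def termWord (t : Term P R) : List Letter := encodeTerm name name t

instance : Code P := ⟨fun p => code (nameWord p)⟩

instance : Code (Term P R) := ⟨fun t => code (termWord t)⟩

instance : Code (Sentence P R) := ⟨fun ψ => code (ψ.alls, ψ.somes)⟩

theorem encodeName_append_inj {v w : List Bool} {l l' : List Letter}
    (h : encodeName v ++ l = encodeName w ++ l') : v = w ∧ l = l' := by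
  induction v generalizing w with
  | nil => cases w <;> simp_all [encodeName]
  | cons a v ih =>
    cases w with
    | nil => simp [encodeName] at h
    | cons b w =>
      simp only [encodeName, List.map_cons, List.cons_append, List.cons.injEq,
        Letter.bit.injEq] at h
      obtain ⟨rfl, rfl⟩ := ih h.2
      exact ⟨by rw [h.1], rfl⟩

theorem nameWord_injective : Function.Injective (nameWord : P → List Letter) := fun p q h =>
  name_injective (encodeName_append_inj (l := []) (l' := []) (by simpa [nameWord] using h)).1

theorem termWord_injective : Function.Injective (termWord : Term P R → List Letter) := by
  intro t
  induction t with
  | noun p =>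
    intro t' h
    cases t' with
    | noun q =>
      simp only [termWord, encodeTerm, List.cons.injEq, true_and] at h
      rw [nameWord_injective h]
    | rAll r x => simp [termWord, encodeTerm] at h
  | rAll r x ih =>
    intro t' h
    cases t' with
    | noun q => simp [termWord, encodeTerm] at h
    | rAll s y =>
      simp only [termWord, encodeTerm, List.cons.injEq, true_and] at h
      obtain ⟨h₁, h₂⟩ := encodeName_append_inj h
      rw [name_injective h₁, ih h₂]

instance : InjCode P := ⟨fun _ _ h => nameWord_injective (InjCode.inj h)⟩

instance : InjCode (Term P R) := ⟨fun _ _ h => termWord_injective (InjCode.inj h)⟩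

/-- A function with the same effect on codes as one computable in polynomial time. -/
theorem FP.of_raw {α β α' β' : Type} [Code α] [Code β] [Code α'] [Code β'] {f : α → β}
    {F : α' → β'} (hF : FP F) (i : α → α') (hi : ∀ a, code (i a) = code a)
    (hf : ∀ a, code (F (i a)) = code (f a)) : FP f := by
  obtain ⟨c, p, h⟩ := hF
  refine ⟨c, p, fun a m r => ?_⟩
  have := h (i a) m r
  rwa [hf, sz, hi] at this

@[fun_prop]
theorem FP.nameWord {α : Type} [Code α] {f : α → P} (hf : FP f) :
    FP (fun x => nameWord (f x)) := (FP.of_code (f := Syllogistic.nameWord) fun _ => rfl).comp hf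

@[fun_prop]
theorem FP.termWord {α : Type} [Code α] {f : α → Term P R} (hf : FP f) :
    FP (fun x => termWord (f x)) := (FP.of_code (f := Syllogistic.termWord) fun _ => rfl).comp hf

@[fun_prop]
theorem FP.rAll {α : Type} [Code α] {f : α → R} {g : α → Term P R} (hf : FP f) (hg : FP g) :
    FP (fun x => Term.rAll (f x) (g x)) :=
  FP.of_raw (F := fun x => Letter.verb :: (Syllogistic.nameWord (f x) ++
    Syllogistic.termWord (g x))) (by fun_prop) _root_.id (fun _ => rfl) (fun _ => rfl)

@[fun_prop]
theorem FP.alls {α : Type} [Code α] {f : α → Sentence P R} (hf : FP f) :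
    FP (fun x => (f x).alls) :=
  FP.fst.comp ((FP.of_code (f := fun ψ : Sentence P R => (ψ.alls, ψ.somes)) fun _ => rfl).comp hf)

@[fun_prop]
theorem FP.somes {α : Type} [Code α] {f : α → Sentence P R} (hf : FP f) :
    FP (fun x => (f x).somes) :=
  FP.snd.comp ((FP.of_code (f := fun ψ : Sentence P R => (ψ.alls, ψ.somes)) fun _ => rfl).comp hf)

/-! ### Correctness of the parser -/

/-- The sentence as the machines see it. -/
def Sentence.raw (ψ : Sentence P R) : RawSentence :=
  (ψ.alls.map (Prod.map termWord termWord), ψ.somes.map (Prod.map termWord termWord))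

theorem readLetter_encodeName (w : List Bool) (s : ParserState) :
    (encodeName w).foldr readLetter s = (encodeName w, s.2) := by
  induction w with
  | nil => rfl
  | cons b w ih =>
    simp only [encodeName, List.map_cons, List.cons_append, List.foldr_cons] at ih ⊢
    rw [ih]
    rfl

/-- Read from the right, prefix notation becomes postfix: a verb symbol finds its name in the
register and its argument on top of the stack. The old content `n` of the register is lost at the
first end marker. -/
theorem readLetter_encodeTerm (t : Term P R) : ∀ (n : List Letter) (st : List (List Letter))
    (ψs φs : List RawSentence) (ts : List (List Letter)) (ds : List (List Letter × List Letter)),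
    (encodeTerm name name t).foldr readLetter (n, st, ψs, φs, ts, ds) =
      ([], termWord t :: st, ψs, φs, t.subs.map termWord ++ ts,
        t.rAlls.map (Prod.map nameWord termWord) ++ ds) := by
  induction t with
  | noun p =>
    intros
    rw [encodeTerm, List.foldr_cons, readLetter_encodeName]
    rfl
  | rAll r x ih =>
    intros
    rw [encodeTerm, List.foldr_cons, List.foldr_append, ih, readLetter_encodeName]
    rfl

theorem readLetter_encodeSentence (ψ : Sentence P R) (n : List Letter)
    (ψs φs : List RawSentence) (ts : List (List Letter)) (ds : List (List Letter × List Letter)) :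
    (encodeSentence name name ψ).foldr readLetter (n, [], ψs, φs, ts, ds) =
      ([], [], ψ.raw :: ψs, φs, (ψ.parts.flatMap Term.subs).map termWord ++ ts,
        (ψ.parts.flatMap Term.rAlls).map (Prod.map nameWord termWord) ++ ds) := by
  cases ψ <;>
    simp [encodeSentence, readLetter_encodeTerm, readLetter, Sentence.raw, Sentence.alls,
      Sentence.somes, Sentence.parts]

/-- The final register is left unspecified because an empty theory does not change it. -/
theorem readLetter_encodeTheory (L : List (Sentence P R)) (n : List Letter)
    (ψs φs : List RawSentence) (ts : List (List Letter)) (ds : List (List Letter × List Letter)) :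
    ∃ n', (encodeTheory name name L).foldr readLetter (n, [], ψs, φs, ts, ds) =
      (n', [], L.map Sentence.raw ++ ψs, φs, (subsOf L).map termWord ++ ts,
        (rAllsOf L).map (Prod.map nameWord termWord) ++ ds) := by
  induction L with
  | nil => exact ⟨n, rfl⟩
  | cons ψ L ih =>
    obtain ⟨n', h⟩ := ih
    refine ⟨[], ?_⟩
    rw [encodeTheory, List.flatMap_cons, List.foldr_append]
    rw [encodeTheory] at h
    rw [h, readLetter_encodeSentence]
    simp [subsOf, rAllsOf]

theorem code_map {α β : Type} [Code α] [Code β] {f : α → β} (hf : ∀ a, code (f a) = code a)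
    (l : List α) : code (l.map f) = code l := by
  induction l with
  | nil => rfl
  | cons a l ih => rw [List.map_cons, code_cons, code_cons, hf, ih]

theorem code_prodMap {α β α' β' : Type} [Code α] [Code β] [Code α'] [Code β'] {f : α → β}
    {f' : α' → β'} (hf : ∀ a, code (f a) = code a) (hf' : ∀ a, code (f' a) = code a)
    (x : α × α') : code (Prod.map f f' x) = code x := by
  rw [code_prod, code_prod x, Prod.map_fst, Prod.map_snd, hf, hf']

theorem code_raw (ψ : Sentence P R) : code ψ.raw = code ψ := by
  have h := code_map (code_prodMap (f := (termWord : Term P R → List Letter))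
    (f' := (termWord : Term P R → List Letter)) (fun _ => rfl) (fun _ => rfl))
  rw [Sentence.raw, code_mk, h, h]
  rfl

theorem code_map_termWord (l : List (Term P R)) : code (l.map termWord) = code l :=
  code_map (f := termWord) (fun _ => rfl) l

theorem code_map_rAlls (l : List (R × Term P R)) :
    code (l.map (Prod.map nameWord termWord)) = code l :=
  code_map (f := Prod.map nameWord termWord)
    (code_prodMap (f := nameWord) (f' := termWord) (fun _ => rfl) (fun _ => rfl)) l

/-- The machine holds the input word reversed, so its left fold is the right fold of the parser over
the word itself. -/
theorem fp_inp_subsOf : FP (fun x : Inp (encodeTheory (P := P) (R := R) name name) =>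
    (subsOf x.val, rAllsOf x.val)) := by
  have h := FP.readLetters (FP.id (α := List Letter))
  have h' : FP fun l : List Letter => (l.foldl (fun s a => readLetter a s) parserInit).2.2.2.2 := by
    fun_prop
  refine FP.of_raw h' (fun x => (encodeTheory name name x.val).reverse) (fun _ => rfl) fun x => ?_
  obtain ⟨n, hn⟩ := readLetter_encodeTheory x.val [] [] [] [] []
  rw [List.foldl_reverse]
  erw [hn]
  simp only [List.append_nil, code_mk]
  rw [code_map_termWord, code_map_rAlls]

/-- The sentence to the right of the turnstile is read first; the turnstile moves it to a slot of
its own before the theory is read. -/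
theorem fp_inp_query : FP (fun x : Inp (encodeQuery (P := P) (R := R) name name) =>
    (x.val.1, [x.val.2], subsOf (x.val.1 ++ [x.val.2]), rAllsOf (x.val.1 ++ [x.val.2]))) := by
  have h := FP.readLetters (FP.id (α := List Letter))
  have h' : FP fun l : List Letter => (l.foldl (fun s a => readLetter a s) parserInit).2.2 := by
    fun_prop
  refine FP.of_raw h' (fun x => (encodeQuery name name x.val).reverse) (fun _ => rfl) fun x => ?_
  have h₁ := readLetter_encodeSentence x.val.2 [] [] [] [] []
  obtain ⟨n, hn⟩ := readLetter_encodeTheory x.val.1 [] [] [x.val.2.raw]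
    ((x.val.2.parts.flatMap Term.subs).map termWord ++ [])
    ((x.val.2.parts.flatMap Term.rAlls).map (Prod.map nameWord termWord) ++ [])
  rw [List.foldl_reverse, encodeQuery, List.foldr_append, List.foldr_cons]
  erw [h₁]
  erw [hn]
  simp only [List.append_nil, code_mk]
  rw [code_map code_raw, ← List.map_append, ← List.map_append,
    code_map_termWord, code_map_rAlls, code_cons, code_raw, code_nil]
  simp [subsOf, rAllsOf, code_cons, code_nil]

end

end Syllogistic

namespace Syllogistic

open Code Named

variable {P R : Type}

/-! ### Computing `g` -/

/-- The list of the terms in `T⁺`. -/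
def plusOf (T : List (Term P R)) (D : List (R × Term P R)) : List (Term P R) :=
  T ++ D.flatMap fun d => T.map fun w => .rAll d.1 w

/-- The sentences `all x y`, `some u v` and `all x y or some u v` with `x`, `u`, `v` in `T` and `y`
in `T'`. -/
def sentencesOver (T T' : List (Term P R)) : List (Sentence P R) :=
  (T.flatMap fun x => T'.map fun y => .all x y) ++
    ((T.flatMap fun u => T.map fun v => .some u v) ++
      T.flatMap fun x => T'.flatMap fun y => T.flatMap fun u => T.map fun v => .allOrSome x y u v)

/-- The set `g`, as a function on lists. -/
def gList (L : List (Sentence P R)) : List (Sentence P R) :=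
  sentencesOver (subsOf L) (plusOf (subsOf L) (rAllsOf L))

theorem mem_plusOf {L : List (Sentence P R)} {x : Term P R} :
    x ∈ plusOf (subsOf L) (rAllsOf L) ↔ x ∈ subtermsPlusOf {ψ | ψ ∈ L} := by
  have h : ∀ r : R, r ∈ verbsOf {ψ | ψ ∈ L} ↔ ∃ d ∈ rAllsOf L, d.1 = r := by
    intro r
    constructor
    · rintro ⟨y, hy⟩
      exact ⟨(r, y), mem_rAllsOf.mpr hy, rfl⟩
    · rintro ⟨⟨s, y⟩, hd, rfl⟩
      exact ⟨y, mem_rAllsOf.mp hd⟩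
  simp only [plusOf, subtermsPlusOf, List.mem_append, List.mem_flatMap, List.mem_map, mem_subsOf,
    Set.mem_union, Set.mem_ofPred_eq, h]
  refine or_congr Iff.rfl ?_
  constructor
  · rintro ⟨d, hd, w, hw, rfl⟩
    exact ⟨d.1, ⟨d, hd, rfl⟩, w, hw, rfl⟩
  · rintro ⟨r, ⟨d, hd, rfl⟩, w, hw, rfl⟩
    exact ⟨d, hd, w, hw, rfl⟩

theorem mem_gList (L : List (Sentence P R)) : {ψ | ψ ∈ gList L} = g {ψ | ψ ∈ L} := by
  ext ψ
  simp only [gList, sentencesOver, g, List.mem_append, List.mem_flatMap, List.mem_map, mem_subsOf,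
    mem_plusOf, Set.mem_ofPred_eq]
  simp only [eq_comm]

section
variable [Named P] [Named R]

/-- In this form the output is a concatenation of words over lists of terms, to which the closure
properties of `FP` apply without forming the sentences themselves as data. -/
theorem encodeTheory_gList (L : List (Sentence P R)) :
    encodeTheory name name (gList L) =
      ((subsOf L).flatMap fun x => (plusOf (subsOf L) (rAllsOf L)).flatMap fun y =>
        Letter.all :: (termWord x ++ termWord y)) ++
      (((subsOf L).flatMap fun u => (subsOf L).flatMap fun v =>
        Letter.some :: (termWord u ++ termWord v)) ++
      (subsOf L).flatMap fun x => (plusOf (subsOf L) (rAllsOf L)).flatMap fun y =>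
        (subsOf L).flatMap fun u => (subsOf L).flatMap fun v =>
          Letter.allOrSome :: (termWord x ++ termWord y ++ termWord u ++ termWord v)) := by
  simp only [encodeTheory, gList, sentencesOver, List.flatMap_append, List.flatMap_assoc,
    List.flatMap_map]
  rfl

@[fun_prop]
theorem FP.plusOf {α : Type} [Code α] {T : α → List (Term P R)} {D : α → List (R × Term P R)}
    (hT : FP T) (hD : FP D) : FP (fun x => plusOf (T x) (D x)) := by
  unfold Syllogistic.plusOf
  fun_prop

theorem FP.wordsOver {α : Type} [Code α] {T T' : α → List (Term P R)} (hT : FP T) (hT' : FP T') :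
    FP (fun x => ((T x).flatMap fun t => (T' x).flatMap fun y =>
        Letter.all :: (Syllogistic.termWord t ++ Syllogistic.termWord y)) ++
      (((T x).flatMap fun u => (T x).flatMap fun v =>
        Letter.some :: (Syllogistic.termWord u ++ Syllogistic.termWord v)) ++
      (T x).flatMap fun t => (T' x).flatMap fun y => (T x).flatMap fun u => (T x).flatMap fun v =>
        Letter.allOrSome :: (Syllogistic.termWord t ++ Syllogistic.termWord y ++
          Syllogistic.termWord u ++ Syllogistic.termWord v))) := by
  fun_prop

theorem pTimeSetFunction_g : PTimeSetFunction (P := P) (R := R) name name g := by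
  refine ⟨gList, mem_gList, polyTime_word (FP.reverse ?_)⟩
  simp only [encodeTheory_gList]
  have h := fp_inp_subsOf (P := P) (R := R)
  exact FP.wordsOver h.fst' (h.fst'.plusOf h.snd')

end

/-! ### Deciding consequence -/

/-- The truth value of `Bad`. -/
noncomputable def badTest (E G : List (Term P R × Term P R)) (u v : Term P R) : Bool :=
  G.any fun p => (isMem (u, p.1) E || isMem (v, p.1) E) && (isMem (u, p.2) E || isMem (v, p.2) E)

/-- Does `all a b` follow from the sentences in `L` and the inclusions in `E` in one step, if the
pairs in `G` have no common instance? -/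
noncomputable def stepTest (T : List (Term P R)) (D : List (R × Term P R))
    (L : List (Sentence P R)) (G E : List (Term P R × Term P R)) (a b : Term P R) : Bool :=
  same a b || (T.any (fun c => isMem (a, c) E && isMem (c, b) E) ||
    (L.any (fun ψ => ψ.somes.all (fun p => badTest E G p.1 p.2) && isMem (a, b) ψ.alls) ||
    (badTest E G a a ||
    D.any fun d => same b (.rAll d.1 d.2) && (badTest E G d.2 d.2 ||
      D.any fun e => same a (.rAll e.1 e.2) && (same d.1 e.1 && isMem (d.2, e.2) E)))))

/-- All pairs of terms in a list. -/
def pairs (T : List (Term P R)) : List (Term P R × Term P R) :=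
  T.flatMap fun a => T.map fun b => (a, b)

/-- All inclusions between terms in `T` which follow in one step. -/
noncomputable def stepList (T : List (Term P R)) (D : List (R × Term P R))
    (L : List (Sentence P R)) (G E : List (Term P R × Term P R)) : List (Term P R × Term P R) :=
  (pairs T).filter fun p => stepTest T D L G E p.1 p.2

/-- All inclusions between terms in `T` which follow. -/
noncomputable def closure (T : List (Term P R)) (D : List (R × Term P R))
    (L : List (Sentence P R)) (G : List (Term P R × Term P R)) : List (Term P R × Term P R) :=
  (pairs T).foldl (fun E _ => stepList T D L G E) []

/-- Does the sentence in `Q` follow from the sentences in `L`? -/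
noncomputable def answer (L Q : List (Sentence P R)) (T : List (Term P R))
    (D : List (R × Term P R)) : Bool :=
  Q.any (fun φ => φ.alls.any fun p => isMem p (closure T D L (Q.flatMap Sentence.somes))) ||
    L.any fun ψ => ψ.alls.all (fun _ => false) && ψ.somes.all fun p =>
      badTest (closure T D L (Q.flatMap Sentence.somes)) (Q.flatMap Sentence.somes) p.1 p.2

/-! ### Polynomial running time of the decision procedure. -/

section
variable [Named P] [Named R] {α : Type} [Code α]

@[fun_prop]
theorem FP.badTest {E G : α → List (Term P R × Term P R)} {u v : α → Term P R} (hE : FP E)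
    (hG : FP G) (hu : FP u) (hv : FP v) : FP (fun x => badTest (E x) (G x) (u x) (v x)) := by
  unfold Syllogistic.badTest
  fun_prop

@[fun_prop]
theorem FP.stepTest {T : α → List (Term P R)} {D : α → List (R × Term P R)}
    {L : α → List (Sentence P R)} {G E : α → List (Term P R × Term P R)} {a b : α → Term P R}
    (hT : FP T) (hD : FP D) (hL : FP L) (hG : FP G) (hE : FP E) (ha : FP a) (hb : FP b) :
    FP (fun x => stepTest (T x) (D x) (L x) (G x) (E x) (a x) (b x)) := by
  unfold Syllogistic.stepTest
  fun_prop

@[fun_prop]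
theorem FP.pairs {T : α → List (Term P R)} (hT : FP T) : FP (fun x => pairs (T x)) := by
  unfold Syllogistic.pairs
  fun_prop

@[fun_prop]
theorem FP.stepList {T : α → List (Term P R)} {D : α → List (R × Term P R)}
    {L : α → List (Sentence P R)} {G E : α → List (Term P R × Term P R)}
    (hT : FP T) (hD : FP D) (hL : FP L) (hG : FP G) (hE : FP E) :
    FP (fun x => stepList (T x) (D x) (L x) (G x) (E x)) := by
  unfold Syllogistic.stepList
  fun_prop

theorem sz_le_of_sublist {β : Type} [Code β] {l l' : List β} (h : l'.Sublist l) : sz l' ≤ sz l := by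
  induction h with
  | slnil => exact le_rfl
  | cons a _ ih => rw [sz_cons]; omega
  | cons_cons a _ ih => rw [sz_cons, sz_cons]; omega

-- Every stage is a sublist of `pairs T`, so the size of that list bounds all accumulators of the
-- fold.
@[fun_prop]
theorem FP.closure {T : α → List (Term P R)} {D : α → List (R × Term P R)}
    {L : α → List (Sentence P R)} {G : α → List (Term P R × Term P R)}
    (hT : FP T) (hD : FP D) (hL : FP L) (hG : FP G) :
    FP (fun x => closure (T x) (D x) (L x) (G x)) := by
  unfold Syllogistic.closure
  obtain ⟨q, hq⟩ := (FP.pairs hT).sz_le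
  refine FP.foldl (by fun_prop) (by fun_prop) (by fun_prop) ⟨q, fun x l' _ => ?_⟩
  refine le_trans (sz_le_of_sublist ?_) (hq x)
  rcases List.eq_nil_or_concat l' with rfl | ⟨l', p, rfl⟩
  · exact List.nil_sublist _
  · rw [List.concat_eq_append, List.foldl_append]
    exact List.filter_sublist

theorem FP.answer {L Q : α → List (Sentence P R)} {T : α → List (Term P R)}
    {D : α → List (R × Term P R)} (hL : FP L) (hQ : FP Q) (hT : FP T) (hD : FP D) :
    FP (fun x => answer (L x) (Q x) (T x) (D x)) := by
  unfold Syllogistic.answer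
  fun_prop

end

end Syllogistic

namespace Syllogistic

variable {P R : Type}

/-! ### Correctness of the decision procedure -/

/-- Every round that changes the increasing chain adds an entry, and a round without change is
repeated forever. -/
theorem iterate_eq_or_lt_length {β : Type} {f : List β → List β}
    (hf : ∀ n, (f^[n] []).Sublist (f^[n + 1] [])) (n : ℕ) :
    f^[n + 1] [] = f^[n] [] ∨ n < (f^[n + 1] []).length := by
  induction n with
  | zero =>
    rcases h : f^[0 + 1] [] with _ | ⟨a, l⟩
    · exact Or.inl rfl
    · exact Or.inr (by simp)
  | succ n ih =>
    rcases ih with h | h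
    · refine Or.inl ?_
      rw [Function.iterate_succ_apply', h, ← Function.iterate_succ_apply' f, h]
    · rcases (hf (n + 1)).length_le.eq_or_lt with h' | h'
      · exact Or.inl ((hf (n + 1)).eq_of_length h').symm
      · exact Or.inr (by omega)

theorem badTest_eq_true {E G : List (Term P R × Term P R)} {u v : Term P R} :
    badTest E G u v = true ↔ Bad (fun a b => (a, b) ∈ E) {p | p ∈ G} u v := by
  simp [badTest, Bad]

theorem Bad.mono {le le' : Term P R → Term P R → Prop} {G : Set (Term P R × Term P R)}
    {u v : Term P R} (h : ∀ a b, le a b → le' a b) (hb : Bad le G u v) : Bad le' G u v := by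
  obtain ⟨p, hp, h₁, h₂⟩ := hb
  exact ⟨p, hp, h₁.imp (h _ _) (h _ _), h₂.imp (h _ _) (h _ _)⟩

section
variable {T : List (Term P R)} {D : List (R × Term P R)} {L : List (Sentence P R)}
  {G E E' : List (Term P R × Term P R)} {a b : Term P R}

theorem stepTest_eq_true : stepTest T D L G E a b = true ↔
    a = b ∨ (∃ c ∈ T, (a, c) ∈ E ∧ (c, b) ∈ E) ∨
    (∃ ψ ∈ L, (∀ p ∈ ψ.somes, Bad (fun a b => (a, b) ∈ E) {p | p ∈ G} p.1 p.2) ∧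
      (a, b) ∈ ψ.alls) ∨
    Bad (fun a b => (a, b) ∈ E) {p | p ∈ G} a a ∨
    ∃ d ∈ D, b = .rAll d.1 d.2 ∧ (Bad (fun a b => (a, b) ∈ E) {p | p ∈ G} d.2 d.2 ∨
      ∃ e ∈ D, a = .rAll e.1 e.2 ∧ d.1 = e.1 ∧ (d.2, e.2) ∈ E) := by
  simp only [stepTest, Bool.or_eq_true, Bool.and_eq_true, List.any_eq_true, List.all_eq_true,
    same_eq_true, isMem_eq_true, badTest_eq_true]

/-- All occurrences of `E` in the test are positive. -/
theorem stepTest_mono (h : E ⊆ E') (hs : stepTest T D L G E a b = true) :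
    stepTest T D L G E' a b = true := by
  have hB : ∀ u v, Bad (fun a b => (a, b) ∈ E) {p | p ∈ G} u v →
      Bad (fun a b => (a, b) ∈ E') {p | p ∈ G} u v := fun _ _ => Bad.mono fun _ _ h' => h h'
  rw [stepTest_eq_true] at hs ⊢
  rcases hs with hs | ⟨c, hc, h₁, h₂⟩ | ⟨ψ, hψ, h₁, h₂⟩ | hs | ⟨d, hd, hb, hs⟩
  · exact Or.inl hs
  · exact Or.inr (Or.inl ⟨c, hc, h h₁, h h₂⟩)
  · exact Or.inr (Or.inr (Or.inl ⟨ψ, hψ, fun p hp => hB _ _ (h₁ p hp), h₂⟩))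
  · exact Or.inr (Or.inr (Or.inr (Or.inl (hB _ _ hs))))
  · refine Or.inr (Or.inr (Or.inr (Or.inr ⟨d, hd, hb, hs.imp (hB _ _) ?_⟩)))
    exact fun ⟨e, he, ha, hr, h'⟩ => ⟨e, he, ha, hr, h h'⟩

theorem stepList_sublist (h : E ⊆ E') : (stepList T D L G E).Sublist (stepList T D L G E') :=
  List.monotone_filter_right _ fun _ hp => stepTest_mono h hp

theorem mem_stepList :
    (a, b) ∈ stepList T D L G E ↔ (a ∈ T ∧ b ∈ T) ∧ stepTest T D L G E a b = true := by
  simp [stepList, pairs]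

theorem closure_eq_iterate :
    closure T D L G = (stepList T D L G)^[(pairs T).length] [] := by
  rw [closure]
  generalize pairs T = l
  generalize ([] : List (Term P R × Term P R)) = E
  induction l generalizing E with
  | nil => rfl
  | cons p l ih => exact ih _

/-- The stages increase by monotonicity of the step and, being sublists of `pairs T`, cannot exceed
its length; so that many rounds reach a fixed point. -/
theorem stepList_closure : stepList T D L G (closure T D L G) = closure T D L G := by
  have hf : ∀ n, ((stepList T D L G)^[n] []).Sublist ((stepList T D L G)^[n + 1] []) := by
    intro n
    induction n with
    | zero => exact List.nil_sublist _
    | succ n ih =>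
      rw [Function.iterate_succ_apply', Function.iterate_succ_apply' _ (n + 1)]
      exact stepList_sublist ih.subset
  rw [closure_eq_iterate, ← Function.iterate_succ_apply' (stepList T D L G)]
  refine (iterate_eq_or_lt_length hf _).resolve_right fun h => ?_
  rw [Function.iterate_succ_apply'] at h
  exact absurd (List.filter_sublist.length_le) (not_le.mpr h)

theorem mem_closure :
    (a, b) ∈ closure T D L G ↔ (a ∈ T ∧ b ∈ T) ∧ stepTest T D L G (closure T D L G) a b = true := by
  conv_lhs => rw [← stepList_closure]
  exact mem_stepList

/-- Each closure condition corresponds to a disjunct of the step test, and a fixed point contains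
every pair over `T` that passes the test. Through `hD` the test recognises the terms `r all a` of
`T`. -/
theorem saturated_closure (hD : ∀ r a, Term.rAll r a ∈ T → (r, a) ∈ D) :
    Saturated {t | t ∈ T} (fun a b => (a, b) ∈ closure T D L G) {p | p ∈ G} where
  refl _ ha := mem_closure.mpr ⟨⟨ha, ha⟩, stepTest_eq_true.mpr (Or.inl rfl)⟩
  mem _ _ h := (mem_closure.mp h).1
  trans _ b _ h₁ h₂ := mem_closure.mpr ⟨⟨(mem_closure.mp h₁).1.1, (mem_closure.mp h₂).1.2⟩,
    stepTest_eq_true.mpr (Or.inr (Or.inl ⟨b, (mem_closure.mp h₁).1.2, h₁, h₂⟩))⟩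
  anti r a b ha hb h := mem_closure.mpr ⟨⟨hb, ha⟩, stepTest_eq_true.mpr
    (Or.inr (Or.inr (Or.inr (Or.inr ⟨(r, a), hD _ _ ha, rfl, Or.inr
      ⟨(r, b), hD _ _ hb, rfl, rfl, h⟩⟩))))⟩
  of_bad _ ha _ hb h := mem_closure.mpr ⟨⟨ha, hb⟩, stepTest_eq_true.mpr
    (Or.inr (Or.inr (Or.inr (Or.inl h))))⟩
  rAll_of_bad r a ha _ hb h := mem_closure.mpr ⟨⟨hb, ha⟩, stepTest_eq_true.mpr
    (Or.inr (Or.inr (Or.inr (Or.inr ⟨(r, a), hD _ _ ha, rfl, Or.inl h⟩))))⟩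

theorem Model.sat_iff (M : Model P R) (ψ : Sentence P R) :
    M.Sat ψ ↔ (∃ p ∈ ψ.alls, M.Sat (.all p.1 p.2)) ∨ ∃ p ∈ ψ.somes, M.Sat (.some p.1 p.2) := by
  cases ψ <;> simp [Sentence.alls, Sentence.somes, Model.Sat]

theorem not_sat_some_of_bad {M : Model P R} {G : Set (Term P R × Term P R)}
    (hG : ∀ p ∈ G, ¬ M.Sat (.some p.1 p.2)) {le : Term P R → Term P R → Prop}
    (hle : ∀ a b, le a b → M.Sat (.all a b)) {u v : Term P R} (h : Bad le G u v) :
    ¬ M.Sat (.some u v) := by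
  rintro ⟨m, hu, hv⟩
  obtain ⟨p, hp, h₁, h₂⟩ := h
  refine hG p hp ⟨m, ?_, ?_⟩
  · exact h₁.elim (fun h => hle _ _ h hu) fun h => hle _ _ h hv
  · exact h₂.elim (fun h => hle _ _ h hu) fun h => hle _ _ h hv

/-- In such a model a bad pair has no common instance. So a premise all of whose existential pairs
are bad must satisfy its universal disjunct, and a term that is bad with itself is empty. -/
theorem Model.sat_of_mem_closure {M : Model P R} (hL : ∀ ψ ∈ L, M.Sat ψ)
    (hG : ∀ p ∈ G, ¬ M.Sat (.some p.1 p.2)) :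
    ∀ a b, (a, b) ∈ closure T D L G → M.Sat (.all a b) := by
  rw [closure_eq_iterate]
  generalize (pairs T).length = n
  induction n with
  | zero => exact fun a b h => absurd h List.not_mem_nil
  | succ n ih =>
    intro a b h
    rw [Function.iterate_succ_apply', mem_stepList, stepTest_eq_true] at h
    generalize (stepList T D L G)^[n] [] = E at *
    have hB : ∀ u v, Bad (fun a b => (a, b) ∈ E) {p | p ∈ G} u v → ¬ M.Sat (.some u v) :=
      fun u v => not_sat_some_of_bad hG ih
    replace h := h.2
    rcases h with rfl | ⟨c, _, h₁, h₂⟩ | ⟨ψ, hψ, h₁, h₂⟩ | h | ⟨d, hd, rfl, h | ⟨e, _, rfl, hr, h⟩⟩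
    · exact subset_rfl
    · exact (ih _ _ h₁).trans (ih _ _ h₂)
    · rcases (M.sat_iff ψ).mp (hL ψ hψ) with ⟨p, hp, h⟩ | ⟨p, hp, h⟩
      -- A sentence has at most one universal disjunct.
      · have : p = (a, b) := by
          cases ψ <;> simp_all [Sentence.alls]
        subst this
        exact h
      · exact absurd h (hB _ _ (h₁ p hp))
    · exact fun m hm => absurd ⟨m, hm, hm⟩ (hB _ _ h)
    · exact fun m _ n hn => absurd ⟨n, hn, hn⟩ (hB _ _ h)
    · rw [hr]
      exact fun m hm n hn => hm n (ih _ _ h hn)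

end

theorem Sentence.mem_constituents {ψ : Sentence P R} {p : Term P R × Term P R}
    (h : p ∈ ψ.alls ∨ p ∈ ψ.somes) : p.1 ∈ ψ.constituents ∧ p.2 ∈ ψ.constituents := by
  cases ψ <;> simp [alls, somes] at h <;> simp [constituents] <;> grind

/-- The test accepts if the universal disjunct of `φ` is in the closure, or if some premise without
universal disjunct has only bad pairs; neither is possible in a model of `L` that refutes `φ`. If
the test rejects, the canonical model of the closure, with the pairs in `φ.somes` forbidden, is a
countermodel. -/
theorem answer_eq_true {L : List (Sentence P R)} {φ : Sentence P R} :
    answer L [φ] (subsOf (L ++ [φ])) (rAllsOf (L ++ [φ])) = true ↔ Entails {ψ | ψ ∈ L} φ := by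
  set T := subsOf (L ++ [φ]) with hT
  set D := rAllsOf (L ++ [φ]) with hD
  have hC : ∀ ψ ∈ L ++ [φ], ∀ p : Term P R × Term P R, (p ∈ ψ.alls ∨ p ∈ ψ.somes) →
      p.1 ∈ T ∧ p.2 ∈ T := fun ψ hψ p hp =>
    ⟨mem_subsOf.mpr (mem_subtermsOf hψ (Sentence.mem_constituents hp).1),
      mem_subsOf.mpr (mem_subtermsOf hψ (Sentence.mem_constituents hp).2)⟩
  have hrT : ∀ r a, Term.rAll r a ∈ T → (r, a) ∈ D := fun r a h =>
    mem_rAllsOf.mpr (mem_subsOf.mp h)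
  have hTT : ∀ r a, Term.rAll r a ∈ {t | t ∈ T} → a ∈ {t | t ∈ T} := fun r a h =>
    mem_subsOf.mpr (mem_subtermsOf_of_rAll (mem_subsOf.mp h))
  have hsat := saturated_closure (L := L) (G := φ.somes) hrT
  have key : answer L [φ] T D = true ↔ (∃ p ∈ φ.alls, p ∈ closure T D L φ.somes) ∨
      ∃ ψ ∈ L, ψ.alls = [] ∧ ∀ p ∈ ψ.somes,
        Bad (fun a b => (a, b) ∈ closure T D L φ.somes) {p | p ∈ φ.somes} p.1 p.2 := by
    simp [answer, badTest_eq_true, List.eq_nil_iff_forall_not_mem]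
  rw [key]
  constructor
  · intro h M hM
    rw [M.sat_iff]
    by_contra! hn
    have hcl := M.sat_of_mem_closure (T := T) (D := D) hM hn.2
    rcases h with ⟨p, hp, h⟩ | ⟨ψ, hψ, hnil, h⟩
    · exact hn.1 p hp (hcl _ _ h)
    · rcases (M.sat_iff ψ).mp (hM ψ hψ) with ⟨p, hp, _⟩ | ⟨p, hp, h'⟩
      · rw [hnil] at hp
        exact absurd hp List.not_mem_nil
      · exact not_sat_some_of_bad hn.2 hcl (h p hp) h'
  · intro h
    by_contra! hn
    set M := canonicalModel {t | t ∈ T} (fun a b => (a, b) ∈ closure T D L φ.somes)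
      {p | p ∈ φ.somes}
    have hφ : φ ∈ L ++ [φ] := by simp
    have hM : M.Sat φ := by
      refine h M fun ψ hψ => ?_
      have hψ' : ψ ∈ L ++ [φ] := List.mem_append_left _ hψ
      rw [M.sat_iff]
      by_contra! hc
      have hb : ∀ p ∈ ψ.somes,
          Bad (fun a b => (a, b) ∈ closure T D L φ.somes) {p | p ∈ φ.somes} p.1 p.2 := by
        intro p hp
        have hp' := hC ψ hψ' p (Or.inr hp)
        by_contra hb
        exact hc.2 p hp ((hsat.sat_some hTT hp'.1 hp'.2).mpr hb)
      -- A premise that fails in the model has only bad existential pairs. Without a universal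
      -- disjunct it would have made the test accept; with one, the step test puts that disjunct
      -- into the closure, so it holds in the model.
      rcases hnil : ψ.alls with _ | ⟨p, l⟩
      · obtain ⟨p, hp, h'⟩ := hn.2 ψ hψ hnil
        exact h' (hb p hp)
      · have hp : p ∈ ψ.alls := by simp [hnil]
        have hp' := hC ψ hψ' p (Or.inl hp)
        refine hc.1 p hp ((hsat.sat_all hTT hp'.1 hp'.2).mpr (mem_closure.mpr ⟨hp', ?_⟩))
        exact stepTest_eq_true.mpr (Or.inr (Or.inr (Or.inl ⟨ψ, hψ, hb, hp⟩)))
    rcases (M.sat_iff φ).mp hM with ⟨p, hp, h'⟩ | ⟨p, hp, h'⟩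
    · have hp' := hC φ hφ p (Or.inl hp)
      exact hn.1 p hp ((hsat.sat_all hTT hp'.1 hp'.2).mp h')
    · have hp' := hC φ hφ p (Or.inr hp)
      exact (hsat.sat_some hTT hp'.1 hp'.2).mp h'
        ⟨p, hp, Or.inl (hsat.refl _ hp'.1), Or.inr (hsat.refl _ hp'.2)⟩

end Syllogistic

/-! ### Membership in PTIME, and the theorem. -/

namespace Syllogistic

open Code Named

section
variable {P R : Type} [Named P] [Named R]

theorem inPTime_entails : InPTime (encodeQuery (P := P) (R := R) name name)
    (fun q => Entails {ψ | ψ ∈ q.1} q.2) := by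
  have h := fp_inp_query (P := P) (R := R)
  refine polyTime_bool ?_
  convert FP.answer h.fst' h.snd'.fst' h.snd'.snd'.fst' h.snd'.snd'.snd' using 2 with x
  rw [Bool.eq_iff_iff, answer_eq_true, @decide_eq_true_iff _ (Classical.propDecidable _)]

/-- A query of the smaller language is written as the same word as its image in the extended
language, so the same program decides it. -/
theorem inPTime_basicEntails : InPTime (encodeBasicQuery (P := P) (R := R) name name)
    (fun q => BasicEntails {ψ | ψ ∈ q.1} q.2) := by
  have h := fp_inp_query (P := P) (R := R)
  refine polyTime_bool ?_
  refine FP.of_raw (FP.answer h.fst' h.snd'.fst' h.snd'.snd'.fst' h.snd'.snd'.snd')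
    (fun x => ⟨(x.val.1.map BasicSentence.toSentence, x.val.2.toSentence)⟩) (fun _ => rfl)
    fun x => congrArg code ?_
  rw [Bool.eq_iff_iff, answer_eq_true, @decide_eq_true_iff _ (Classical.propDecidable _)]
  simp [Entails, BasicEntails]

end

end Syllogistic

theorem mainTheorem2 (P R : Type) :
    Syllogistic.Sound P R Syllogistic.extendedSystem ∧
    (∀ (Γ : Set (Syllogistic.Sentence P R)) (φ : Syllogistic.Sentence P R),
      Syllogistic.Entails Γ φ →
        Syllogistic.ProvesIn Syllogistic.extendedSystem (Syllogistic.g (insert φ Γ)) Γ φ) ∧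
    (∀ (codeP : P → List Bool) (codeR : R → List Bool),
      Function.Injective codeP → Function.Injective codeR →
        Syllogistic.PTimeSetFunction codeP codeR Syllogistic.g ∧
        Syllogistic.BoundedlyComplete codeP codeR Syllogistic.extendedSystem ∧
        Syllogistic.InPTime (Syllogistic.encodeQuery codeP codeR)
          (fun q : List (Syllogistic.Sentence P R) × Syllogistic.Sentence P R =>
            Syllogistic.Entails {ψ | ψ ∈ q.1} q.2) ∧
        Syllogistic.InPTime (Syllogistic.encodeBasicQuery codeP codeR)
          (fun q : List (Syllogistic.BasicSentence P R) × Syllogistic.BasicSentence P R =>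
            Syllogistic.BasicEntails {ψ | ψ ∈ q.1} q.2)) := by
  refine ⟨Syllogistic.sound_extendedSystem, fun Γ φ h => Syllogistic.provesIn_of_entails h,
    fun codeP codeR hP hR => ?_⟩
  let _ : Syllogistic.Named P := ⟨codeP, hP⟩
  let _ : Syllogistic.Named R := ⟨codeR, hR⟩
  exact ⟨Syllogistic.pTimeSetFunction_g,
    ⟨Syllogistic.sound_extendedSystem, Syllogistic.g, Syllogistic.pTimeSetFunction_g,
      fun _ _ _ h => Syllogistic.provesIn_of_entails h⟩,
    Syllogistic.inPTime_entails, Syllogistic.inPTime_basicEntails⟩
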